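/- Links and knots are unoriented, tangles are taken up to isotopy fixing their end points. A band attachment on a knot $K\subset S^3$ is \emph{chirally cosmetic} if it is non-coherent (the number of components is preserved) and the resulting knot is the mirror image of $K$. Let $R$ be a tangle diagram in a rectangular box with two end points on the upper and two on the lower side of the box, and let $\overline R$ be its reflection in a horizontal line. Build a link diagram $K(R)$ with a band $b$ as follows (the plane is read from top to bottom). Below a box $R$ let $\ell$ and $r$ be the strands that start at its lower left and lower right end points, and let $o_\ell$ and $o_r$ be the strands that start at its upper left and upper right end points and run down to the left and to the right of the box. * Insert a local maximum between $\ell$ and $r$; its left leg $m_\ell$ crosses $\ell$ (passing over $\ell$) to the position between $o_\ell$ and $\ell$, and its right leg $m_r$ crosses $r$ (passing under $r$) to the position between $r$ and $o_r$. * The band $b$ joins $\ell$ to $r$ by a horizontal band with one half twist. (To draw $b$ flat, $r$ is given a kink: a local maximum is inserted between $\ell$ and $r$, its right leg crosses $r$ with the strand from upper left to lower right passing over, and the strand that thereby arrives next to the left leg is joined to it by a local minimum; $b$ is the flat horizontal band from $\ell$ to the left leg of this local maximum.) * Below $b$, the strand $o_\ell$ crosses under $m_\ell$ and then over $\ell$,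 the strand $o_r$ crosses over $m_r$ and then under $r$, and $o_\ell$ and $o_r$ are joined by a local minimum between $\ell$ and $r$. * The strands $\ell$ and $r$ cross once, the strand from upper right to lower left ($r$) passing over, and run into the upper end points of the box $\overline R$; the lower left and lower right end points of $\overline R$ are joined to $m_\ell$ and $m_r$ respectively. Call $R$ \emph{symmetric} if it is isotopic (fixing end points) to its image under the rotation by $\pi$ in space about the vertical axis of the box, i.e. to the diagram obtained by reflecting the picture of $R$ in the vertical axis and changing all crossings. Then: 1. For every symmetric $R$ such that $K(R)$ is a knot, the band $b$ on $K(R)$ is chirally cosmetic. 2. Let $R$ be one of the following symmetric tangles, all of whose crossings have the strand from upper left to lower right passing over: one crossing; a horizontal row of three half-twists; the horizontal sum of one crossing on the left and a vertical column of two half-twists on the right. Then $K(R)$ is, respectively, the knot $5_1$, the mirror image of $7_3$, and the knot $8_8$, and $b$ is chirally cosmetic on it. Here $5_1$, $7_3$, $8_8$ denote the closures of the braids $\sigma_1^{-5}$, $\sigma_1^5\sigma_2\sigma_1^{-1}\sigma_2$ and $\sigma_1^3\sigma_2\sigma_1^{-1}\sigma_3^{-1}\sigma_2\sigma_3^{-2}$,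 with $\sigma_i$ a right-handed crossing. 3. The construction gives an infinite family: there are symmetric tangles $R_0,R_1,R_2,\dots$ such that $b$ is a chirally cosmetic band on the knot $K(R_n)$ for every $n$, and for $m\ne n$ the knot $K(R_m)$ is isotopic neither to $K(R_n)$ nor to its mirror image. -/

import Mathlib

/-!
Unoriented links and tangles in `S³`, presented by diagrams in general position with respect to the
height function of the plane: a diagram is cut into horizontal slices, each containing one local
maximum, one local minimum or one crossing, and ambient isotopy (fixing the end points of a tangle)
is the equivalence relation generated by the standard moves on sliced diagrams.
-/

namespace SlicedDiagram

/-- The non-trivial piece of a slice. Diagrams are read from top to bottom. -/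
inductive Piece
  /-- a local maximum: two adjacent strands are born -/
  | cap
  /-- a local minimum: two adjacent strands are joined -/
  | cup
  /-- two adjacent strands cross, the strand from lower left to upper right passing over -/
  | pos
  /-- two adjacent strands cross, the strand from upper left to lower right passing over -/
  | neg

namespace Piece

/-- Number of strands entering the piece from above. -/
def inputs : Piece → ℕ
  | cap => 0
  | cup => 2
  | pos => 2
  | neg => 2

/-- Number of strands leaving the piece below. -/
def outputs : Piece → ℕ
  | cap => 2
  | cup => 0
  | pos => 2
  | neg => 2

/-- Crossing change: the reflection in the plane of the diagram. -/
def mirror : Piece → Piece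
  | cap => cap
  | cup => cup
  | pos => neg
  | neg => pos

/-- Reflection of the picture in a horizontal line. -/
def upsideDown : Piece → Piece
  | cap => cup
  | cup => cap
  | pos => neg
  | neg => pos

/-- The piece is a crossing. -/
def IsCrossing (c : Piece) : Prop := c = pos ∨ c = neg

end Piece

/-- A slice: the piece, and the number of vertical strands to the left of it. The number of vertical
strands to the right is determined by the number of strands entering the slice. -/
structure Slice where
  piece : Piece
  left : ℕ

/-- A diagram: its slices from top to bottom. -/
abbrev Diagram := List Slice

/-- The slices of `D` fit together to a tangle diagram with `n` end points at the top
and `m` end points at the bottom. -/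
def IsTangle : ℕ → Diagram → ℕ → Prop
  | n, [], m => n = m
  | n, s :: D, m =>
      s.left + s.piece.inputs ≤ n ∧ IsTangle (n - s.piece.inputs + s.piece.outputs) D m

/-- The local moves: exchange of the heights of two distant pieces, straightening of a zigzag,
the three Reidemeister moves, and sliding a strand across a local maximum or minimum. -/
inductive Move : Diagram → Diagram → Prop
  | exchange (p q : Piece) (i k : ℕ) :
      Move [⟨q, i + p.inputs + k⟩, ⟨p, i⟩] [⟨p, i⟩, ⟨q, i + p.outputs + k⟩]
  | zigzagLeft (i : ℕ) : Move [⟨.cap, i⟩, ⟨.cup, i + 1⟩] []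
  | zigzagRight (i : ℕ) : Move [⟨.cap, i + 1⟩, ⟨.cup, i⟩] []
  | reidemeisterOneCap (c : Piece) (hc : c.IsCrossing) (i : ℕ) :
      Move [⟨.cap, i⟩, ⟨c, i⟩] [⟨.cap, i⟩]
  | reidemeisterOneCup (c : Piece) (hc : c.IsCrossing) (i : ℕ) :
      Move [⟨c, i⟩, ⟨.cup, i⟩] [⟨.cup, i⟩]
  | reidemeisterTwo (c : Piece) (hc : c.IsCrossing) (i : ℕ) :
      Move [⟨c, i⟩, ⟨c.mirror, i⟩] []
  | reidemeisterThree (c : Piece) (hc : c.IsCrossing) (i : ℕ) :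
      Move [⟨c, i⟩, ⟨c, i + 1⟩, ⟨c, i⟩] [⟨c, i + 1⟩, ⟨c, i⟩, ⟨c, i + 1⟩]
  | slideCap (c : Piece) (hc : c.IsCrossing) (i : ℕ) :
      Move [⟨.cap, i⟩, ⟨c, i + 1⟩] [⟨.cap, i + 1⟩, ⟨c.mirror, i⟩]
  | slideCup (c : Piece) (hc : c.IsCrossing) (i : ℕ) :
      Move [⟨c, i + 1⟩, ⟨.cup, i⟩] [⟨c.mirror, i⟩, ⟨.cup, i + 1⟩]

/-- Two tangle diagrams with `n` top and `m` bottom end points differ by one move applied to some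
consecutive slices. -/
def Step (n m : ℕ) (D E : Diagram) : Prop :=
  IsTangle n D m ∧ IsTangle n E m ∧
    ∃ A B l r : Diagram, Move l r ∧ D = A ++ l ++ B ∧ E = A ++ r ++ B

/-- Isotopy (relative to the end points) of tangles with `n` top and `m` bottom end points. -/
def Isotopic (n m : ℕ) : Diagram → Diagram → Prop := Relation.EqvGen (Step n m)

/-- Isotopy of links. -/
abbrev LinkIsotopic : Diagram → Diagram → Prop := Isotopic 0 0

/-- The mirror image: all crossings are changed. -/
def mirror (D : Diagram) : Diagram := D.map fun s => ⟨s.piece.mirror, s.left⟩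

/-- Reflection of the picture in a horizontal line. -/
def upsideDown (D : Diagram) : Diagram := (D.map fun s => ⟨s.piece.upsideDown, s.left⟩).reverse

/-- The diagram placed to the right of `k` vertical strands. -/
def shift (k : ℕ) (D : Diagram) : Diagram := D.map fun s => ⟨s.piece, s.left + k⟩

/-- Rotation of a tangle with `n` top end points by the angle `π` in space about the vertical axis of
the diagram. The picture is reflected in the vertical axis and the upper and the lower
strand of every crossing are exchanged; together these preserve the type of each crossing. -/
def rotate : ℕ → Diagram → Diagram
  | _, [] => []
  | n, s :: D => ⟨s.piece, n - s.piece.inputs - s.left⟩ ::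
      rotate (n - s.piece.inputs + s.piece.outputs) D

/-- The number of ways of colouring the strands of `D` by two colours, constantly along each strand,
when the colours of the top end points are given from left to right. -/
def colourings : Diagram → List Bool → ℕ
  | [], _ => 1
  | ⟨.cap, i⟩ :: D, x =>
      colourings D (x.take i ++ [false, false] ++ x.drop i) +
        colourings D (x.take i ++ [true, true] ++ x.drop i)
  | ⟨.cup, i⟩ :: D, x =>
      if x[i]? = x[i + 1]? then colourings D (x.take i ++ x.drop (i + 2)) else 0
  | ⟨.pos, i⟩ :: D, x => colourings D (x.take i ++ ((x.drop i).take 2).reverse ++ x.drop (i + 2))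
  | ⟨.neg, i⟩ :: D, x => colourings D (x.take i ++ ((x.drop i).take 2).reverse ++ x.drop (i + 2))

/-- `D` is a link diagram with exactly `k` components. The components can be coloured independently,
so a link with `k` components has `2 ^ k` colourings by two colours. -/
def IsLink (k : ℕ) (D : Diagram) : Prop := IsTangle 0 D 0 ∧ colourings D [] = 2 ^ k

/-- `D` is a knot diagram. -/
abbrev IsKnot (D : Diagram) : Prop := IsLink 1 D

/-- Surgery of the link diagram `A ++ B` along the flat band that joins, between `A` and `B`, the
strand with `i` strands to its left to the strand next to it on its right: the two vertical arcs are
replaced by a local minimum above a local maximum. -/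
def bandSurgery (A : Diagram) (i : ℕ) (B : Diagram) : Diagram := A ++ [⟨.cup, i⟩, ⟨.cap, i⟩] ++ B

/-- The band joining strands `i` and `i + 1` (counted from `0`) of the knot diagram `A ++ B` between
`A` and `B` is chirally cosmetic: it is non-coherent (surgery preserves the number of
components) and surgery along it produces the mirror image of the knot. -/
def IsChirallyCosmetic (A : Diagram) (i : ℕ) (B : Diagram) : Prop :=
  IsKnot (A ++ B) ∧ IsKnot (bandSurgery A i B) ∧ LinkIsotopic (bandSurgery A i B) (mirror (A ++ B))

/-- `R` is a tangle with two end points at the top and two at the bottom, isotopic relative to its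
end points to its image under the rotation by `π` about the vertical axis. -/
def IsSymmetricTangle (R : Diagram) : Prop := IsTangle 2 R 2 ∧ Isotopic 2 2 R (rotate 2 R)

/-- The part above the band of the knot diagram built from the tangle `R`. The upper end points of
the box `R` are joined to strands that run down on both sides of it; below the box, a local maximum is
inserted between the strands coming from its lower end points; the left leg of this maximum crosses
over the strand from the lower left corner, the right leg under the strand from the lower right one.
The last slice is one half of a kink, whose other half is below the band (so that the band, which
is a half-twisted band between two parallel strands, is flat in the diagram). -/
def aboveBand (R : Diagram) : Diagram :=
  [⟨.cap, 0⟩, ⟨.cap, 2⟩] ++ shift 1 R ++ [⟨.cap, 2⟩, ⟨.pos, 1⟩, ⟨.pos, 3⟩, ⟨.cap, 3⟩]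

/-- The part below the band: the other half of the kink; then the two outermost strands (from the
upper end points of `R`) cross the next two strands on their way inwards and are joined; then a half
twist of the two middle strands, which run into the reflection of `R` in a horizontal line, whose
lower end points are joined to the two remaining strands. -/
def belowBand (R : Diagram) : Diagram :=
  [⟨.neg, 4⟩, ⟨.cup, 3⟩, ⟨.pos, 0⟩, ⟨.neg, 1⟩, ⟨.pos, 4⟩, ⟨.neg, 3⟩, ⟨.cup, 2⟩, ⟨.pos, 1⟩] ++
    shift 1 (upsideDown R) ++ [⟨.cup, 0⟩, ⟨.cup, 0⟩]

/-- The knot (or link) diagram built from the tangle `R`. -/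
def knotOf (R : Diagram) : Diagram := aboveBand R ++ belowBand R

/-- The band of the construction, on the diagram `knotOf R`, is chirally cosmetic. -/
def BandIsChirallyCosmetic (R : Diagram) : Prop := IsChirallyCosmetic (aboveBand R) 2 (belowBand R)

/-- One half-twist. -/
def oneHalfTwist : Diagram := [⟨.neg, 0⟩]

/-- Three half-twists: three crossings side by side in a horizontal row. -/
def threeHalfTwists : Diagram :=
  [⟨.cap, 1⟩, ⟨.cap, 1⟩, ⟨.neg, 0⟩, ⟨.neg, 2⟩, ⟨.cup, 1⟩, ⟨.neg, 2⟩, ⟨.cup, 1⟩]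

/-- One crossing, and to the right of it two crossings in a vertical column. -/
def threeCrossingTangle : Diagram :=
  [⟨.cap, 1⟩, ⟨.neg, 0⟩, ⟨.neg, 2⟩, ⟨.neg, 2⟩, ⟨.cup, 1⟩]

/-- The closure of the braid on `n` strands given by a word in the standard generators `σ₁, σ₂, …`
(right-handed crossings) and their inverses: `j` stands for `σⱼ` and `-j` for its inverse. -/
def braidClosure (n : ℕ) (b : List ℤ) : Diagram :=
  (List.range n).map (fun j => ⟨.cap, j⟩) ++
    b.map (fun x => ⟨if 0 < x then .pos else .neg, x.natAbs - 1⟩) ++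
    (List.range n).reverse.map (fun j => ⟨.cup, j⟩)

/-- The knot `5₁` of the standard tables. -/
def knotFiveOne : Diagram := braidClosure 2 [-1, -1, -1, -1, -1]

/-- The knot `7₃` of the standard tables. -/
def knotSevenThree : Diagram := braidClosure 3 [1, 1, 1, 1, 1, 2, -1, 2]

/-- The knot `8₈` of the standard tables. -/
def knotEightEight : Diagram := braidClosure 4 [1, 1, 1, 2, -1, -3, 2, -3, -3]

end SlicedDiagram

namespace SlicedDiagram

/-! ### Tangle diagrams and isotopy in context -/

/-! The band is cosmetic because of one global symmetry. Rotating the surgered diagram in its plane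
by `π` exchanges the two boxes: the upper box becomes the mirror image of `R` rotated about the
vertical axis, the lower one the mirror image of `upsideDown R`, likewise rotated. Symmetry of `R`
undoes the rotation of the upper box. The rotation of the lower box is undone by a half twist of
four strands: a half twist can be pushed through any tangle, which is thereby rotated, and below the
closing minima no strands are left to twist. What remains is an isotopy of the four-strand tangle
between the boxes, independent of `R`: `halfTurn_surgeryMiddle`. The general facts behind this are
`nestedCaps_append` (rotation in the plane) and `halfTwist_append` (rotation about the vertical
axis); they are combined in `surgery_isotopic`.

The concrete isotopies, including the identifications of `5₁`, `7₃` and `8₈`, are lists of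
elementary steps. Every step is proved sound once and for all, so `TangleIso.of_ops` reduces each of
them to a computation.

Colourings by an involutory quandle are counted to obtain invariants (`Isotopic.numColourings_eq`).
The trivial quandle on two elements counts components, so the surgered link is a knot as soon as it
is isotopic to the mirror image of one. Dihedral quandles separate the infinite family: for a column
of `n` half-twists, the colourings over a finite commutative ring correspond to the pairs `(a, b)`
with `(4n² + 1)(b - a) = 0`, and the same holds for the mirror image. Modulo `4n² + 1` this
condition is empty for `n` but not for any `m < n`. -/

instance decidableIsTangle : ∀ (n : ℕ) (D : Diagram) (m : ℕ), Decidable (IsTangle n D m)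
  | n, [], m => inferInstanceAs (Decidable (n = m))
  | n, s :: D, m =>
      haveI := decidableIsTangle (n - s.piece.inputs + s.piece.outputs) D m
      inferInstanceAs (Decidable (s.left + s.piece.inputs ≤ n ∧
        IsTangle (n - s.piece.inputs + s.piece.outputs) D m))

theorem isTangle_append {n m : ℕ} {A B : Diagram} :
    IsTangle n (A ++ B) m ↔ ∃ k, IsTangle n A k ∧ IsTangle k B m := by
  induction A generalizing n with
  | nil => simp [IsTangle]
  | cons s A ih => simp [IsTangle, ih, and_assoc]

theorem IsTangle.append {n k m : ℕ} {A B : Diagram} (hA : IsTangle n A k) (hB : IsTangle k B m) :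
    IsTangle n (A ++ B) m := isTangle_append.2 ⟨k, hA, hB⟩

theorem IsTangle.unique {n m m' : ℕ} {D : Diagram} (h : IsTangle n D m) (h' : IsTangle n D m') :
    m = m' := by
  induction D generalizing n with
  | nil => exact h.symm.trans h'
  | cons s D ih => exact ih h.2 h'.2

theorem isTangle_slice (p : Piece) (i k : ℕ) :
    IsTangle (i + p.inputs + k) [⟨p, i⟩] (i + p.outputs + k) := by
  cases p <;> simp [IsTangle, Piece.inputs, Piece.outputs] <;> omega

theorem IsTangle.cast {n m n' m' : ℕ} {D : Diagram} (h : IsTangle n D m)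
    (hn : n = n' := by omega) (hm : m = m' := by omega) : IsTangle n' D m' := hn ▸ hm ▸ h

theorem IsTangle.widen {n m : ℕ} {D : Diagram} (h : IsTangle n D m) (k : ℕ) :
    IsTangle (n + k) D (m + k) := by
  induction D generalizing n with
  | nil => exact congrArg (· + k) h
  | cons s D ih =>
    refine ⟨h.1.trans (Nat.le_add_right _ _), ?_⟩
    have := ih h.2
    have h1 := h.1
    exact this.cast

theorem IsTangle.shift {n m : ℕ} {D : Diagram} (h : IsTangle n D m) (k : ℕ) :
    IsTangle (n + k) (shift k D) (m + k) := by
  induction D generalizing n with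
  | nil => exact congrArg (· + k) h
  | cons s D ih =>
    have h1 := h.1
    refine ⟨?_, ?_⟩
    · show s.left + k + s.piece.inputs ≤ n + k
      omega
    · refine (ih h.2).cast ?_ rfl
      show n - s.piece.inputs + s.piece.outputs + k = n + k - s.piece.inputs + s.piece.outputs
      omega

theorem shift_append (k : ℕ) (A B : Diagram) : shift k (A ++ B) = shift k A ++ shift k B :=
  List.map_append

theorem shift_shift (j k : ℕ) (A : Diagram) : shift j (shift k A) = shift (k + j) A := by
  simp [shift, Function.comp_def, Nat.add_assoc]

theorem shift_zero (A : Diagram) : shift 0 A = A := by simp [shift]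

theorem Piece.mirror_mirror (p : Piece) : p.mirror.mirror = p := by cases p <;> rfl

theorem Piece.upsideDown_upsideDown (p : Piece) : p.upsideDown.upsideDown = p := by cases p <;> rfl

theorem Piece.IsCrossing.mirror {c : Piece} (hc : c.IsCrossing) : c.mirror.IsCrossing := by
  rcases hc with rfl | rfl
  · exact Or.inr rfl
  · exact Or.inl rfl

theorem Piece.IsCrossing.inputs {c : Piece} (hc : c.IsCrossing) : c.inputs = 2 := by
  rcases hc with rfl | rfl <;> rfl

theorem Piece.IsCrossing.outputs {c : Piece} (hc : c.IsCrossing) : c.outputs = 2 := by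
  rcases hc with rfl | rfl <;> rfl

theorem Move.shift {l r : Diagram} (h : Move l r) (k : ℕ) :
    Move (shift k l) (SlicedDiagram.shift k r) := by
  cases h with
  | exchange p q i j =>
    have := Move.exchange p q (i + k) j
    simp only [SlicedDiagram.shift, List.map_cons, List.map_nil]
    rw [show i + p.inputs + j + k = i + k + p.inputs + j by omega,
      show i + p.outputs + j + k = i + k + p.outputs + j by omega]
    exact this
  | zigzagLeft i =>
    have := Move.zigzagLeft (i + k)
    simp only [SlicedDiagram.shift, List.map_cons, List.map_nil, Nat.add_right_comm i 1 k]
    exact this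
  | zigzagRight i =>
    have := Move.zigzagRight (i + k)
    simp only [SlicedDiagram.shift, List.map_cons, List.map_nil, Nat.add_right_comm i 1 k]
    exact this
  | reidemeisterOneCap c hc i => exact Move.reidemeisterOneCap c hc (i + k)
  | reidemeisterOneCup c hc i => exact Move.reidemeisterOneCup c hc (i + k)
  | reidemeisterTwo c hc i => exact Move.reidemeisterTwo c hc (i + k)
  | reidemeisterThree c hc i =>
    have := Move.reidemeisterThree c hc (i + k)
    simp only [SlicedDiagram.shift, List.map_cons, List.map_nil, Nat.add_right_comm i 1 k]
    exact this
  | slideCap c hc i =>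
    have := Move.slideCap c hc (i + k)
    simp only [SlicedDiagram.shift, List.map_cons, List.map_nil, Nat.add_right_comm i 1 k]
    exact this
  | slideCup c hc i =>
    have := Move.slideCup c hc (i + k)
    simp only [SlicedDiagram.shift, List.map_cons, List.map_nil, Nat.add_right_comm i 1 k]
    exact this

theorem Step.widen {n m : ℕ} {D E : Diagram} (h : Step n m D E) (k : ℕ) :
    Step (n + k) (m + k) D E :=
  ⟨h.1.widen k, h.2.1.widen k, h.2.2⟩

theorem Step.shift {n m : ℕ} {D E : Diagram} (h : Step n m D E) (k : ℕ) :
    Step (n + k) (m + k) (shift k D) (SlicedDiagram.shift k E) := by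
  obtain ⟨hD, hE, A, B, l, r, hm, rfl, rfl⟩ := h
  refine ⟨hD.shift k, hE.shift k, SlicedDiagram.shift k A, SlicedDiagram.shift k B, _, _,
    hm.shift k, ?_, ?_⟩ <;> simp [shift_append]

theorem Step.context {n m k l : ℕ} {D E A B : Diagram} (h : Step n m D E) (hA : IsTangle k A n)
    (hB : IsTangle m B l) : Step k l (A ++ D ++ B) (A ++ E ++ B) := by
  obtain ⟨hD, hE, A', B', x, y, hm, rfl, rfl⟩ := h
  exact ⟨(hA.append hD).append hB, (hA.append hE).append hB, A ++ A', B' ++ B, x, y, hm,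
    by simp, by simp⟩

/-- An operation on diagrams need only be checked on a single step; this is how context, shift,
widening and mirror image pass to isotopies. -/
theorem Isotopic.map {n m n' m' : ℕ} (f : Diagram → Diagram)
    (hf : ∀ D E, Step n m D E → Isotopic n' m' (f D) (f E)) {D E : Diagram}
    (h : Isotopic n m D E) : Isotopic n' m' (f D) (f E) := by
  induction h with
  | rel D E h => exact hf D E h
  | refl D => exact Relation.EqvGen.refl _
  | symm D E _ ih => exact ih.symm
  | trans D E F _ _ ih ih' => exact ih.trans _ _ _ ih'

theorem Isotopic.isTangle_iff {n m : ℕ} {D E : Diagram} (h : Isotopic n m D E) :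
    IsTangle n D m ↔ IsTangle n E m := by
  induction h with
  | rel D E h => exact ⟨fun _ => h.2.1, fun _ => h.1⟩
  | refl D => rfl
  | symm D E _ ih => exact ih.symm
  | trans D E F _ _ ih ih' => exact ih.trans ih'

/-- Both diagrams are tangle diagrams, and they are isotopic. -/
structure TangleIso (n m : ℕ) (D E : Diagram) : Prop where
  source : IsTangle n D m
  target : IsTangle n E m
  isotopic : Isotopic n m D E

namespace TangleIso

variable {n m k l : ℕ} {A B D E F D' E' : Diagram}

theorem of_isotopic (h : Isotopic n m D E) (hD : IsTangle n D m) : TangleIso n m D E :=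
  ⟨hD, h.isTangle_iff.1 hD, h⟩

theorem refl (h : IsTangle n D m) : TangleIso n m D D := ⟨h, h, Relation.EqvGen.refl _⟩

theorem of_eq (h : IsTangle n D m) (e : D = E) : TangleIso n m D E := e ▸ refl h

theorem symm (h : TangleIso n m D E) : TangleIso n m E D :=
  ⟨h.2, h.1, h.3.symm⟩

theorem trans (h : TangleIso n m D E) (h' : TangleIso n m E F) : TangleIso n m D F :=
  ⟨h.1, h'.2, h.3.trans _ _ _ h'.3⟩

theorem of_move (h : Move D E) (hD : IsTangle n D m) (hE : IsTangle n E m) : TangleIso n m D E :=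
  ⟨hD, hE, Relation.EqvGen.rel _ _ ⟨hD, hE, [], [], D, E, h, by simp, by simp⟩⟩

theorem cast (h : TangleIso n m D E) (hn : n = k := by omega) (hm : m = l := by omega) :
    TangleIso k l D E := hn ▸ hm ▸ h

theorem context (h : TangleIso n m D E) (hA : IsTangle k A n) (hB : IsTangle m B l) :
    TangleIso k l (A ++ D ++ B) (A ++ E ++ B) :=
  ⟨(hA.append h.1).append hB, (hA.append h.2).append hB,
    h.3.map (fun X => A ++ X ++ B) fun _ _ hs => Relation.EqvGen.rel _ _ (hs.context hA hB)⟩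

theorem append_left (h : TangleIso n m D E) (hA : IsTangle k A n) :
    TangleIso k m (A ++ D) (A ++ E) := by
  simpa using h.context hA (B := []) rfl

theorem append_right (h : TangleIso n m D E) (hB : IsTangle m B l) :
    TangleIso n l (D ++ B) (E ++ B) := by
  simpa using h.context (A := []) rfl hB

theorem append (h : TangleIso n k D E) (h' : TangleIso k m D' E') :
    TangleIso n m (D ++ D') (E ++ E') :=
  (h.append_right h'.1).trans (h'.append_left h.2)

theorem widen (h : TangleIso n m D E) (k : ℕ) : TangleIso (n + k) (m + k) D E :=
  ⟨h.1.widen k, h.2.widen k, h.3.map id fun _ _ hs => Relation.EqvGen.rel _ _ (hs.widen k)⟩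

theorem shift (h : TangleIso n m D E) (k : ℕ) :
    TangleIso (n + k) (m + k) (shift k D) (SlicedDiagram.shift k E) :=
  ⟨h.1.shift k, h.2.shift k, h.3.map _ fun _ _ hs => Relation.EqvGen.rel _ _ (hs.shift k)⟩

end TangleIso

/-- The exchange move phrased by the widths `a` and `b` of two adjacent blocks instead of the gap
between the pieces, the form that inductions over side-by-side tangles need. -/
theorem slice_exchange (s t : Slice) (a b : ℕ) (hs : s.left + s.piece.inputs ≤ a)
    (ht : t.left + t.piece.inputs ≤ b) :
    TangleIso (a + b) (a - s.piece.inputs + s.piece.outputs + (b - t.piece.inputs + t.piece.outputs))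
      [⟨t.piece, t.left + a⟩, s]
      [s, ⟨t.piece, t.left + (a - s.piece.inputs + s.piece.outputs)⟩] := by
  obtain ⟨p, i⟩ := s
  obtain ⟨q, j⟩ := t
  simp only at *
  obtain ⟨k, rfl⟩ := Nat.exists_eq_add_of_le hs
  have := Move.exchange p q i (k + j)
  have e1 : i + p.inputs + k - p.inputs = i + k := by omega
  rw [e1]
  have e2 : j + (i + p.inputs + k) = i + p.inputs + (k + j) := by omega
  have e3 : j + (i + k + p.outputs) = i + p.outputs + (k + j) := by omega
  rw [e2, e3]
  refine .of_move this ?_ ?_ <;> simp [IsTangle] <;> omega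

theorem slice_interchange {b b' : ℕ} {B : Diagram} (s : Slice) (a : ℕ)
    (hs : s.left + s.piece.inputs ≤ a) (hB : IsTangle b B b') :
    TangleIso (a + b) (a - s.piece.inputs + s.piece.outputs + b')
      (shift a B ++ [s]) (s :: shift (a - s.piece.inputs + s.piece.outputs) B) := by
  induction B generalizing b with
  | nil =>
    obtain rfl : b = b' := hB
    refine .refl ?_
    simp [IsTangle, shift]
    omega
  | cons t B ih =>
    have h1 := ih hB.2
    have ht : IsTangle (a + b) [⟨t.piece, t.left + a⟩] (a + (b - t.piece.inputs + t.piece.outputs)) := by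
      have := hB.1
      simp [IsTangle]; omega
    have h2 := h1.append_left ht
    refine h2.trans ?_
    have h3 := slice_exchange s t a b hs hB.1
    have := h3.append_right ((hB.2.shift (a - s.piece.inputs + s.piece.outputs)).cast
      (m' := a - s.piece.inputs + s.piece.outputs + b'))
    simpa [shift] using this

/-- Two tangles side by side may be slid past each other vertically. -/
theorem interchange {a a' b b' : ℕ} {A B : Diagram} (hA : IsTangle a A a') (hB : IsTangle b B b') :
    TangleIso (a + b) (a' + b') (shift a B ++ A) (A ++ shift a' B) := by
  induction A generalizing a with
  | nil =>
    obtain rfl : a = a' := hA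
    simpa using TangleIso.refl ((hB.shift a).cast)
  | cons s A ih =>
    have h1 := (slice_interchange s a hA.1 hB).append_right (hA.2.widen b')
    have h2 := (ih hA.2).append_left (A := [s]) (k := a + b) (by
      have := hA.1
      simp [IsTangle]; omega)
    exact (by simpa using h1 : TangleIso _ _ (shift a B ++ s :: A) _).trans (by simpa using h2)

/-! ### Symmetries of diagrams -/

theorem IsTangle.mirror {n m : ℕ} {D : Diagram} (h : IsTangle n D m) : IsTangle n (mirror D) m := by
  induction D generalizing n with
  | nil => exact h
  | cons s D ih =>
    obtain ⟨p, i⟩ := s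
    cases p <;> exact ⟨h.1, ih h.2⟩

theorem mirror_append (A B : Diagram) : mirror (A ++ B) = mirror A ++ mirror B := List.map_append

theorem mirror_shift (k : ℕ) (A : Diagram) : mirror (shift k A) = shift k (mirror A) := by
  simp [mirror, shift]

theorem upsideDown_append (A B : Diagram) :
    upsideDown (A ++ B) = upsideDown B ++ upsideDown A := by
  simp [upsideDown]

theorem upsideDown_cons (s : Slice) (A : Diagram) :
    upsideDown (s :: A) = upsideDown A ++ [⟨s.piece.upsideDown, s.left⟩] := by
  simp [upsideDown]

theorem upsideDown_upsideDown (A : Diagram) : upsideDown (upsideDown A) = A := by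
  simp [upsideDown, Function.comp_def, Piece.upsideDown_upsideDown]

theorem upsideDown_shift (k : ℕ) (A : Diagram) :
    upsideDown (shift k A) = shift k (upsideDown A) := by
  simp [upsideDown, shift]

theorem isTangle_upsideDown_slice {n : ℕ} {s : Slice} (h : s.left + s.piece.inputs ≤ n) :
    IsTangle (n - s.piece.inputs + s.piece.outputs) [⟨s.piece.upsideDown, s.left⟩] n := by
  obtain ⟨p, i⟩ := s
  cases p <;> simp [IsTangle, Piece.upsideDown, Piece.inputs, Piece.outputs] at h ⊢ <;> omega

theorem IsTangle.upsideDown {n m : ℕ} {D : Diagram} (h : IsTangle n D m) :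
    IsTangle m (upsideDown D) n := by
  induction D generalizing n with
  | nil => exact h.symm
  | cons s D ih =>
    rw [upsideDown_cons]
    exact (ih h.2).append (isTangle_upsideDown_slice h.1)

theorem isTangle_rotate {n m : ℕ} {D : Diagram} (h : IsTangle n D m) :
    IsTangle n (rotate n D) m := by
  induction D generalizing n with
  | nil => exact h
  | cons s D ih =>
    refine ⟨?_, ih h.2⟩
    have := h.1
    simp only
    omega

theorem Move.mirror {l r : Diagram} (h : Move l r) :
    Move (mirror l) (SlicedDiagram.mirror r) := by
  cases h with
  | exchange p q i j =>
    have hi : ∀ p : Piece, p.mirror.inputs = p.inputs := by intro p; cases p <;> rfl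
    have ho : ∀ p : Piece, p.mirror.outputs = p.outputs := by intro p; cases p <;> rfl
    have := Move.exchange p.mirror q.mirror i j
    rwa [hi, ho] at this
  | zigzagLeft i => exact Move.zigzagLeft i
  | zigzagRight i => exact Move.zigzagRight i
  | reidemeisterOneCap c hc i => exact Move.reidemeisterOneCap _ hc.mirror i
  | reidemeisterOneCup c hc i => exact Move.reidemeisterOneCup _ hc.mirror i
  | reidemeisterTwo c hc i => exact Move.reidemeisterTwo _ hc.mirror i
  | reidemeisterThree c hc i => exact Move.reidemeisterThree _ hc.mirror i
  | slideCap c hc i => exact Move.slideCap _ hc.mirror i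
  | slideCup c hc i => exact Move.slideCup _ hc.mirror i

theorem TangleIso.mirror {n m : ℕ} {D E : Diagram} (h : TangleIso n m D E) :
    TangleIso n m (mirror D) (SlicedDiagram.mirror E) := by
  refine ⟨h.1.mirror, h.2.mirror, h.3.map _ ?_⟩
  rintro _ _ ⟨hD, hE, A, B, l, r, hm, rfl, rfl⟩
  exact .rel _ _ ⟨hD.mirror, hE.mirror, SlicedDiagram.mirror A, SlicedDiagram.mirror B, _, _,
    hm.mirror, by simp [mirror_append], by simp [mirror_append]⟩

theorem rotate_append {n k : ℕ} {A : Diagram} (h : IsTangle n A k) (B : Diagram) :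
    rotate n (A ++ B) = rotate n A ++ rotate k B := by
  induction A generalizing n with
  | nil =>
    obtain rfl : n = k := h
    rfl
  | cons s A ih => simp [rotate, ih h.2]

/-- The `k` vertical strands on the left and the `j` on the right trade sides, so the result is
shifted by `j`. -/
theorem rotate_shift {n m : ℕ} {A : Diagram} (h : IsTangle n A m) (k j : ℕ) :
    rotate (n + (k + j)) (shift k A) = shift j (rotate n A) := by
  induction A generalizing n with
  | nil => rfl
  | cons s A ih =>
    have h1 := h.1
    have := ih h.2
    have e : n + (k + j) - s.piece.inputs + s.piece.outputs
      = n - s.piece.inputs + s.piece.outputs + (k + j) := by omega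
    simp only [shift, rotate, List.map_cons, e] at this ⊢
    rw [this]
    congr 2
    omega

theorem rotate_upsideDown {n m : ℕ} {A : Diagram} (h : IsTangle n A m) :
    rotate m (upsideDown A) = upsideDown (rotate n A) := by
  induction A generalizing n with
  | nil => rfl
  | cons s A ih =>
    rw [upsideDown_cons, rotate_append h.2.upsideDown, ih h.2, rotate.eq_2 n, upsideDown_cons]
    have h1 := h.1
    have hi : s.piece.upsideDown.inputs = s.piece.outputs := by cases s.piece <;> rfl
    simp only [rotate, hi]
    congr 3
    omega

theorem rotate_mirror (n : ℕ) (A : Diagram) : rotate n (mirror A) = mirror (rotate n A) := by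
  induction A generalizing n with
  | nil => rfl
  | cons s A ih =>
    obtain ⟨p, i⟩ := s
    have := ih (n - p.inputs + p.outputs)
    cases p <;> simp_all [mirror, rotate, Piece.mirror, Piece.inputs, Piece.outputs]

/-! ### Rotation of a diagram in its plane by the angle `π` -/

/-- Rotation of a tangle diagram with `n` top end points by the angle `π` in its plane. -/
def halfTurn (n : ℕ) (D : Diagram) : Diagram := mirror (upsideDown (rotate n D))

theorem IsTangle.halfTurn {n m : ℕ} {D : Diagram} (h : IsTangle n D m) :
    IsTangle m (halfTurn n D) n := (isTangle_rotate h).upsideDown.mirror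

theorem halfTurn_append {n k : ℕ} {A : Diagram} (h : IsTangle n A k) (B : Diagram) :
    halfTurn n (A ++ B) = halfTurn k B ++ halfTurn n A := by
  simp [halfTurn, rotate_append h, upsideDown_append, mirror_append]

theorem halfTurn_shift {n m : ℕ} {A : Diagram} (h : IsTangle n A m) (k j : ℕ) :
    halfTurn (n + (k + j)) (shift k A) = shift j (halfTurn n A) := by
  simp [halfTurn, rotate_shift h, upsideDown_shift, mirror_shift]

/-! ### Pulling a tangle around nested maxima -/

/-- `n` nested local maxima. -/
def nestedCaps (n : ℕ) : Diagram := (List.range n).map fun j => ⟨.cap, j⟩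

theorem isTangle_nestedCaps (n : ℕ) : IsTangle 0 (nestedCaps n) (n + n) := by
  induction n with
  | zero => rfl
  | succ n ih =>
    rw [nestedCaps, List.range_succ, List.map_append]
    refine ih.append ?_
    simp [IsTangle, Piece.inputs, Piece.outputs]
    omega

theorem nestedCaps_add (a b : ℕ) : nestedCaps (a + b) = nestedCaps a ++ shift a (nestedCaps b) := by
  simp [nestedCaps, shift, List.range_add, Function.comp_def, Nat.add_comm]

/-- A crossing is carried from the right legs of two nested maxima to the left legs by two slides.
Each slide reverses the crossing type, so the type is restored. A maximum or minimum on the right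
legs becomes its opposite on the left by straightening a zigzag. -/
theorem nestedCaps_slice_inner (p : Piece) :
    TangleIso 0 (p.inputs + p.outputs) (nestedCaps p.inputs ++ [⟨p, p.inputs⟩])
      (nestedCaps p.outputs ++ [⟨p.upsideDown.mirror, 0⟩]) := by
  have cross : ∀ c : Piece, c.IsCrossing →
      TangleIso 0 4 [⟨.cap, 0⟩, ⟨.cap, 1⟩, ⟨c, 2⟩] [⟨.cap, 0⟩, ⟨.cap, 1⟩, ⟨c, 0⟩] := by
    intro c hc
    have e1 : TangleIso 2 4 [⟨.cap, 1⟩, ⟨c, 2⟩] [⟨.cap, 2⟩, ⟨c.mirror, 1⟩] :=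
      .of_move (.slideCap c hc 1) (by rcases hc with rfl | rfl <;> decide)
        (by rcases hc with rfl | rfl <;> decide)
    have e2 : TangleIso 0 4 [⟨.cap, 0⟩, ⟨.cap, 0⟩] [⟨.cap, 0⟩, ⟨.cap, 2⟩] :=
      .of_move (.exchange .cap .cap 0 0) (by decide) (by decide)
    have e3 : TangleIso 2 4 [⟨.cap, 0⟩, ⟨c.mirror, 1⟩] [⟨.cap, 1⟩, ⟨c, 0⟩] := by
      have := Move.slideCap c.mirror hc.mirror 0
      rw [Piece.mirror_mirror] at this
      exact .of_move this (by rcases hc with rfl | rfl <;> decide)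
        (by rcases hc with rfl | rfl <;> decide)
    have h1 := e1.append_left (A := [⟨.cap, 0⟩]) (k := 0) (by decide)
    have h2 := e2.append_right (B := [⟨c.mirror, 1⟩]) (l := 4)
      (by rcases hc with rfl | rfl <;> decide)
    have h3 := e3.append_left (A := [⟨.cap, 0⟩]) (k := 0) (by decide)
    exact h1.trans (h2.symm.trans h3)
  cases p with
  | cap =>
    have : TangleIso 2 2 [⟨.cap, 1⟩, ⟨.cup, 0⟩] [] :=
      .of_move (.zigzagRight 0) (by decide) rfl
    exact (this.append_left (A := [⟨.cap, 0⟩]) (k := 0)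
      (by decide)).symm
  | cup =>
    have : TangleIso 2 2 [⟨.cap, 1⟩, ⟨.cup, 2⟩] [] :=
      .of_move (.zigzagLeft 1) (by decide) rfl
    exact this.append_left (A := [⟨.cap, 0⟩]) (k := 0)
      (by decide)
  | pos => exact cross _ (Or.inl rfl)
  | neg => exact cross _ (Or.inr rfl)

/-- The `i` innermost arcs are disjoint from the piece: it is slid above them on the right, carried
around the arcs it meets, and slid below them again on the left. The `k` outermost arcs are only
context. -/
theorem nestedCaps_slice (p : Piece) (k i : ℕ) :
    TangleIso 0 (k + p.inputs + i + (k + p.outputs + i))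
      (nestedCaps (k + p.inputs + i) ++ [⟨p, k + p.inputs + i + i⟩])
      (nestedCaps (k + p.outputs + i) ++ [⟨p.upsideDown.mirror, k⟩]) := by
  have hin : p.upsideDown.mirror.inputs = p.outputs := by cases p <;> rfl
  have hout : p.upsideDown.mirror.outputs = p.inputs := by cases p <;> rfl
  simp only [nestedCaps_add]
  have two : ∀ q, IsTangle 0 (nestedCaps k ++ shift k (nestedCaps q)) (k + q + (k + q)) :=
    fun q => by rw [← nestedCaps_add]; exact isTangle_nestedCaps _
  have f1 := ((((interchange (isTangle_nestedCaps i) (isTangle_slice p 0 0)).symm).shift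
    (k + p.inputs)).widen k).cast (k := k + p.inputs + (k + p.inputs))
    (l := k + p.inputs + i + (k + p.outputs + i))
  have f2 := f1.append_left (two p.inputs)
  have h1 := (((nestedCaps_slice_inner p).shift k).widen k).cast (k := k + k)
    (l := k + p.inputs + (k + p.outputs))
  have h2 := (h1.append_left (isTangle_nestedCaps k)).append_right
    (B := shift (k + p.inputs) (nestedCaps i)) (l := k + p.inputs + i + (k + p.outputs + i))
    ((((isTangle_nestedCaps i).shift (k + p.inputs)).widen (k + p.outputs)).cast)
  have i0 := isTangle_slice p.upsideDown.mirror 0 0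
  rw [hin, hout] at i0
  have i1 := (((interchange i0 (isTangle_nestedCaps i)).shift k).widen (k + p.outputs)).cast
    (k := k + p.outputs + (k + p.outputs)) (l := k + p.inputs + i + (k + p.outputs + i))
  have i2 := i1.append_left (two p.outputs)
  have t := f2.trans (.trans (.of_eq f2.2 ?_) (h2.trans (.trans (.of_eq h2.2 ?_) i2.symm)))
  · convert t using 1
    · simp [shift_append, shift_shift, Nat.add_comm, Nat.add_left_comm]
      simp [shift]
      omega
    · simp [shift_append, shift_shift, Nat.add_comm]
      simp [shift]
  · simp [shift_append]
    simp [shift]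
    omega
  · simp [shift_append]
    simp [shift]
    intros
    omega

/-- The right ends of nested arcs may be pulled to the left ends through a tangle. -/
theorem nestedCaps_append {n m : ℕ} {T : Diagram} (hT : IsTangle n T m) :
    TangleIso 0 (n + m) (nestedCaps n ++ shift n T) (nestedCaps m ++ halfTurn n T) := by
  induction T generalizing n with
  | nil =>
    obtain rfl : n = m := hT
    exact .refl (by simpa [shift] using isTangle_nestedCaps n)
  | cons s T ih =>
    obtain ⟨p, i⟩ := s
    obtain ⟨k, hk⟩ := Nat.exists_eq_add_of_le hT.1
    simp only at hk
    obtain rfl : n = k + p.inputs + i := by omega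
    have hT2 := hT.2
    simp only at hT2
    have e : k + p.inputs + i - p.inputs + p.outputs = k + p.outputs + i := by omega
    rw [e] at hT2
    have hin : p.upsideDown.mirror.inputs = p.outputs := by cases p <;> rfl
    have hout : p.upsideDown.mirror.outputs = p.inputs := by cases p <;> rfl
    have h1 := (nestedCaps_slice p k i).append_right (B := shift (k + p.inputs + i) T)
      (l := k + p.inputs + i + m) (hT2.shift _).cast
    have s1 := isTangle_slice p.upsideDown.mirror k i
    rw [hin, hout] at s1
    have h2 := (interchange s1 hT2).symm.append_left (isTangle_nestedCaps (k + p.outputs + i))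
    have h3 := (ih hT2).append_right (s1.widen m)
    have key : halfTurn (k + p.inputs + i) (⟨p, i⟩ :: T)
        = halfTurn (k + p.outputs + i) T ++ [⟨p.upsideDown.mirror, k⟩] := by
      have : k + p.inputs + i - p.inputs - i = k := by omega
      simp [halfTurn, rotate, upsideDown_cons, mirror_append, e, this]
      simp [mirror]
    rw [key]
    have t : TangleIso 0 (k + p.inputs + i + m) _ _ :=
      h1.trans (.trans (.of_eq h1.2 ?_) (h2.trans (.trans (.of_eq h2.2 ?_) h3)))
    · convert t using 1
      · simp [shift, Nat.add_comm, Nat.add_left_comm]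
      · simp
    · simp
    · simp

/-- A link diagram is isotopic to its image under the rotation of the plane by `π`. -/
theorem TangleIso.halfTurn {D : Diagram} (h : IsTangle 0 D 0) : TangleIso 0 0 D (halfTurn 0 D) := by
  simpa [nestedCaps, shift_zero] using nestedCaps_append h

/-! ### Half twists and rotation about the vertical axis -/

theorem crossing_cancel {c : Piece} (hc : c.IsCrossing) (i k : ℕ) :
    TangleIso (i + 2 + k) (i + 2 + k) [⟨c, i⟩, ⟨c.mirror, i⟩] [] := by
  refine .of_move (.reidemeisterTwo c hc i) ?_ rfl
  simp [IsTangle, hc.inputs, hc.outputs, hc.mirror.inputs, hc.mirror.outputs]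
  omega

theorem crossing_cancel' {c : Piece} (hc : c.IsCrossing) (i k : ℕ) :
    TangleIso (i + 2 + k) (i + 2 + k) [⟨c.mirror, i⟩, ⟨c, i⟩] [] := by
  simpa [Piece.mirror_mirror] using crossing_cancel hc.mirror i k

theorem isTangle_crossing {c : Piece} (hc : c.IsCrossing) {i n : ℕ} (h : i + 2 ≤ n := by omega) :
    IsTangle n [⟨c, i⟩] n := by
  simp [IsTangle, hc.inputs, hc.outputs]
  omega

/-- Reidemeister three is given only for three crossings of equal type. When `p` is opposite to `c`,
a cancelling pair is inserted at each end and the equal-type move is used in the reverse direction.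
-/
theorem reidemeisterThree_up {c p : Piece} (hc : c.IsCrossing) (hp : p.IsCrossing) :
    TangleIso 3 3 [⟨c, 0⟩, ⟨c, 1⟩, ⟨p, 0⟩] [⟨p, 1⟩, ⟨c, 0⟩, ⟨c, 1⟩] := by
  have r3 : TangleIso 3 3 [⟨c, 0⟩, ⟨c, 1⟩, ⟨c, 0⟩] [⟨c, 1⟩, ⟨c, 0⟩, ⟨c, 1⟩] :=
    .of_move (.reidemeisterThree c hc 0) (by rcases hc with rfl | rfl <;> decide)
      (by rcases hc with rfl | rfl <;> decide)
  have h : p = c ∨ p = c.mirror := by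
    rcases hc with rfl | rfl <;> rcases hp with rfl | rfl <;> simp [Piece.mirror]
  rcases h with rfl | rfl
  · exact r3
  · have t := isTangle_crossing (n := 3) hc.mirror (i := 1)
    have t0 := isTangle_crossing (n := 3) hc.mirror (i := 0)
    have h1 := (crossing_cancel' hc 1 0).append_right
      (B := [⟨c, 0⟩, ⟨c, 1⟩, ⟨c.mirror, 0⟩]) (l := 3) (by rcases hc with rfl | rfl <;> decide)
    have h2 := (r3.append_left t).append_right t0
    have h3 := (crossing_cancel hc 0 1).append_left
      (A := [⟨c.mirror, 1⟩, ⟨c, 0⟩, ⟨c, 1⟩]) (k := 3) (by rcases hc with rfl | rfl <;> decide)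
    exact h1.symm.trans (h2.symm.trans h3)

theorem reidemeisterThree_down {c p : Piece} (hc : c.IsCrossing) (hp : p.IsCrossing) :
    TangleIso 3 3 [⟨c, 1⟩, ⟨c, 0⟩, ⟨p, 1⟩] [⟨p, 0⟩, ⟨c, 1⟩, ⟨c, 0⟩] := by
  have r3 : TangleIso 3 3 [⟨c, 1⟩, ⟨c, 0⟩, ⟨c, 1⟩] [⟨c, 0⟩, ⟨c, 1⟩, ⟨c, 0⟩] :=
    .symm <| .of_move (.reidemeisterThree c hc 0) (by rcases hc with rfl | rfl <;> decide)
      (by rcases hc with rfl | rfl <;> decide)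
  have h : p = c ∨ p = c.mirror := by
    rcases hc with rfl | rfl <;> rcases hp with rfl | rfl <;> simp [Piece.mirror]
  rcases h with rfl | rfl
  · exact r3
  · have t := isTangle_crossing (n := 3) hc.mirror (i := 0)
    have t0 := isTangle_crossing (n := 3) hc.mirror (i := 1)
    have h1 := (crossing_cancel' hc 0 1).append_right
      (B := [⟨c, 1⟩, ⟨c, 0⟩, ⟨c.mirror, 1⟩]) (l := 3) (by rcases hc with rfl | rfl <;> decide)
    have h2 := (r3.append_left t).append_right t0
    have h3 := (crossing_cancel hc 1 0).append_left
      (A := [⟨c.mirror, 0⟩, ⟨c, 1⟩, ⟨c, 0⟩]) (k := 3) (by rcases hc with rfl | rfl <;> decide)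
    exact h1.symm.trans (h2.symm.trans h3)

/-! ### Strands passing across a tangle, and half twists -/

/-- The leftmost strand crosses the next `n` strands. -/
def pass (c : Piece) (n : ℕ) : Diagram := (List.range n).map fun j => ⟨c, j⟩

theorem pass_add (c : Piece) (a b : ℕ) : pass c (a + b) = pass c a ++ shift a (pass c b) := by
  simp [pass, shift, List.range_add, Function.comp_def, Nat.add_comm]

theorem pass_succ (c : Piece) (n : ℕ) : pass c (n + 1) = pass c n ++ [⟨c, n⟩] := by
  simp [pass, List.range_succ]

theorem isTangle_pass {c : Piece} (hc : c.IsCrossing) (n : ℕ) :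
    IsTangle (n + 1) (pass c n) (n + 1) := by
  induction n with
  | zero => rfl
  | succ n ih =>
    rw [pass_succ]
    exact (ih.widen 1).append (isTangle_crossing hc)

/-- A strand lying entirely over or entirely under can be moved across any piece: across a crossing
by Reidemeister three, across a maximum or minimum by a slide followed by a cancellation. -/
theorem pass_slice_inner {c : Piece} (hc : c.IsCrossing) (p : Piece) :
    TangleIso (p.inputs + 1) (p.outputs + 1) (pass c p.inputs ++ [⟨p, 0⟩])
      (⟨p, 1⟩ :: pass c p.outputs) := by
  cases p with
  | cap =>
    have h1 : TangleIso 1 3 [⟨.cap, 1⟩, ⟨c, 0⟩] [⟨.cap, 0⟩, ⟨c.mirror, 1⟩] := by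
      have := Move.slideCap c.mirror hc.mirror 0
      rw [Piece.mirror_mirror] at this
      exact .symm (.of_move this (by rcases hc with rfl | rfl <;> decide)
        (by rcases hc with rfl | rfl <;> decide))
    have h2 := h1.append_right (isTangle_crossing (n := 3) hc (i := 1))
    have h3 := (crossing_cancel' hc 1 0).append_left (A := [⟨.cap, 0⟩]) (k := 1) (by decide)
    exact (h2.trans h3).symm
  | cup =>
    have h1 : TangleIso 3 1 [⟨c, 1⟩, ⟨.cup, 0⟩] [⟨c.mirror, 0⟩, ⟨.cup, 1⟩] :=
      .of_move (.slideCup c hc 0) (by rcases hc with rfl | rfl <;> decide)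
        (by rcases hc with rfl | rfl <;> decide)
    have h2 := h1.append_left (isTangle_crossing (n := 3) hc (i := 0))
    have h3 := (crossing_cancel hc 0 1).append_right (B := [⟨.cup, 1⟩]) (l := 1) (by decide)
    exact h2.trans h3
  | pos => exact reidemeisterThree_up hc (Or.inl rfl)
  | neg => exact reidemeisterThree_up hc (Or.inr rfl)

theorem pass_slice {c : Piece} (hc : c.IsCrossing) (p : Piece) (k i : ℕ) :
    TangleIso (k + p.inputs + i + 1) (k + p.outputs + i + 1) (pass c (k + p.inputs + i) ++ [⟨p, k⟩])
      (⟨p, k + 1⟩ :: pass c (k + p.outputs + i)) := by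
  simp only [pass_add]
  have f0 := isTangle_slice p 0 0
  have pk : ∀ q : ℕ, IsTangle (k + q + i + 1) (pass c k) (k + q + i + 1) := fun q =>
    ((isTangle_pass hc k).widen (q + i)).cast
  have pq : ∀ q : ℕ, IsTangle (k + q + i + 1) (shift k (pass c q)) (k + q + i + 1) := fun q =>
    (((isTangle_pass hc q).shift k).widen i).cast
  have pi : ∀ q : ℕ, IsTangle (k + q + i + 1) (shift (k + q) (pass c i)) (k + q + i + 1) :=
    fun q => ((isTangle_pass hc i).shift (k + q)).cast
  have g1 := ((interchange f0 (isTangle_pass hc i)).shift k).cast (k := k + p.inputs + i + 1)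
    (l := k + p.outputs + i + 1)
  have g2 := g1.append_left ((pk p.inputs).append (pq p.inputs))
  have h1 := (((pass_slice_inner hc p).shift k).widen i).cast (k := k + p.inputs + i + 1)
    (l := k + p.outputs + i + 1)
  have h2 := (h1.append_left (pk p.inputs)).append_right (pi p.outputs)
  have i1 := ((interchange (isTangle_pass hc k) f0).widen i).cast (k := k + p.inputs + i + 1)
    (l := k + p.outputs + i + 1)
  have i2 := i1.append_right ((pq p.outputs).append (pi p.outputs))
  have t := g2.trans (.trans (.of_eq g2.2 ?_) (h2.trans (.trans (.of_eq h2.2 ?_) i2.symm)))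
  · convert t using 1
    · simp [shift_append, shift_shift, Nat.add_comm]
      simp [shift]
    · simp [shift]
  · simp [shift_append]
    simp [shift]
    intros
    omega
  · simp [shift]
    omega

/-- Two strands pass the next `n` strands together. -/
def doublePass (c : Piece) : ℕ → Diagram
  | 0 => []
  | n + 1 => doublePass c n ++ [⟨c, n + 1⟩, ⟨c, n⟩]

theorem isTangle_doublePass {c : Piece} (hc : c.IsCrossing) (n : ℕ) :
    IsTangle (n + 2) (doublePass c n) (n + 2) := by
  induction n with
  | zero => rfl
  | succ n ih =>
    exact (ih.widen 1).append ((isTangle_crossing (i := n + 1) hc).append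
      (isTangle_crossing (i := n) hc))

/-- The two travelling strands may cross each other at the start instead of on the way; afterwards
they run as a parallel pair, along which a piece can be transported. -/
theorem pass_pass {c : Piece} (hc : c.IsCrossing) (n : ℕ) :
    TangleIso (n + 2) (n + 2) (pass c (n + 1) ++ pass c n) (⟨c, 0⟩ :: doublePass c n) := by
  induction n with
  | zero => exact .refl (isTangle_crossing (i := 0) (n := 2) hc)
  | succ n ih =>
    have h1 := (ih.widen 1).append_right (B := [⟨c, n + 1⟩, ⟨c, n⟩])
      ((isTangle_crossing (i := n + 1) (n := n + 2 + 1) hc).append (isTangle_crossing (i := n) hc))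
    have h2 := (interchange (isTangle_pass hc n) (isTangle_crossing (i := 0) (n := 2) hc)).symm
    have h3 := ((h2.append_right (isTangle_crossing (i := n) hc)).append_left
      ((isTangle_pass hc (n + 1)).widen 1))
    refine (TangleIso.of_eq ?_ ?_).trans (h3.symm.trans ((TangleIso.of_eq ?_ ?_).trans h1))
    · exact (isTangle_pass hc _).append ((isTangle_pass hc _).widen 1)
    · rw [pass_succ c (n + 1), pass_succ c n]
      simp [shift]
    · exact h3.1
    · simp [shift]

theorem doublePass_crossing {c p : Piece} (hc : c.IsCrossing) (hp : p.IsCrossing) (n : ℕ) :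
    TangleIso (n + 2) (n + 2) (doublePass c n ++ [⟨p, n⟩]) (⟨p, 0⟩ :: doublePass c n) := by
  induction n with
  | zero => exact .refl (isTangle_crossing hp)
  | succ n ih =>
    have h1 := (((reidemeisterThree_down hc hp).shift n).cast (k := n + 2 + 1)
      (l := n + 2 + 1)).append_left ((isTangle_doublePass hc n).widen 1)
    have h2 := (ih.widen 1).append_right (B := [⟨c, n + 1⟩, ⟨c, n⟩])
      ((isTangle_crossing (i := n + 1) hc).append (isTangle_crossing (i := n) hc))
    refine (TangleIso.of_eq ?_ ?_).trans (h1.trans ((TangleIso.of_eq ?_ ?_).trans h2))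
    · exact (isTangle_doublePass hc _).append (isTangle_crossing hp)
    · simp [doublePass, shift, Nat.add_comm]
    · exact h1.2
    · simp [shift, Nat.add_comm]

theorem doublePass_cap {c : Piece} (hc : c.IsCrossing) (n : ℕ) :
    TangleIso n (n + 2) (⟨.cap, 0⟩ :: doublePass c n) [⟨.cap, n⟩] := by
  induction n with
  | zero => exact .refl (D := [⟨.cap, 0⟩]) (by decide)
  | succ n ih =>
    have l1 : TangleIso 1 3 [⟨.cap, 0⟩, ⟨c, 1⟩] [⟨.cap, 1⟩, ⟨c.mirror, 0⟩] :=
      .of_move (.slideCap c hc 0) (by rcases hc with rfl | rfl <;> decide)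
        (by rcases hc with rfl | rfl <;> decide)
    have l2 := (l1.append_right (isTangle_crossing (i := 0) hc)).trans
      ((crossing_cancel' hc 0 1).append_left (A := [⟨.cap, 1⟩]) (k := 1) (by decide))
    have h1 := (ih.widen 1).append_right (B := [⟨c, n + 1⟩, ⟨c, n⟩])
      ((isTangle_crossing (i := n + 1) (n := n + 2 + 1) hc).append (isTangle_crossing (i := n) hc))
    have h2 := (l2.shift n).cast (k := n + 1) (l := n + 2 + 1)
    refine h1.trans ((TangleIso.of_eq h1.2 ?_).trans (h2.trans (.of_eq h2.2 ?_)))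
    · simp [shift, Nat.add_comm]
    · simp [shift, Nat.add_comm]

theorem doublePass_cup {c : Piece} (hc : c.IsCrossing) (n : ℕ) :
    TangleIso (n + 2) n (doublePass c n ++ [⟨.cup, n⟩]) [⟨.cup, 0⟩] := by
  induction n with
  | zero => exact .refl (D := [⟨.cup, 0⟩]) (n := 2) (by decide)
  | succ n ih =>
    have l1 : TangleIso 3 1 [⟨c.mirror, 0⟩, ⟨.cup, 1⟩] [⟨c, 1⟩, ⟨.cup, 0⟩] :=
      .symm <| .of_move (.slideCup c hc 0) (by rcases hc with rfl | rfl <;> decide)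
        (by rcases hc with rfl | rfl <;> decide)
    have l0 : TangleIso 3 1 [⟨c, 0⟩, ⟨.cup, 1⟩] [⟨c.mirror, 1⟩, ⟨.cup, 0⟩] := by
      have := Move.slideCup c.mirror hc.mirror 0
      rw [Piece.mirror_mirror] at this
      exact .symm <| .of_move this (by rcases hc with rfl | rfl <;> decide)
        (by rcases hc with rfl | rfl <;> decide)
    have l2 := (l0.append_left (isTangle_crossing (i := 1) hc)).trans
      ((crossing_cancel hc 1 0).append_right (B := [⟨.cup, 0⟩]) (l := 1) (by decide))
    have h1 := ((l2.shift n).cast (k := n + 2 + 1) (l := n + 1)).append_left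
      ((isTangle_doublePass hc n).widen 1)
    refine (TangleIso.of_eq ?_ ?_).trans (h1.trans ((TangleIso.of_eq h1.2 ?_).trans (ih.widen 1)))
    · exact (isTangle_doublePass hc (n + 1)).append (by simp [IsTangle, Piece.inputs, Piece.outputs])
    · simp [doublePass, shift, Nat.add_comm]
    · simp [shift]

/-- The half twist of `n` strands. -/
def halfTwist (c : Piece) : ℕ → Diagram
  | 0 => []
  | n + 1 => pass c n ++ halfTwist c n

theorem isTangle_halfTwist {c : Piece} (hc : c.IsCrossing) (n : ℕ) :
    IsTangle n (halfTwist c n) n := by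
  induction n with
  | zero => rfl
  | succ n ih => exact (isTangle_pass hc n).append (ih.widen 1)

/-- By `pass_pass` the half twist is one crossing of a pair, a double pass of the pair across `n`
strands, and a half twist of those `n` strands. The piece commutes with the last factor and slides
along the pair to its crossing. There a crossing commutes, while a maximum or minimum absorbs or
creates the crossing by Reidemeister one. -/
theorem halfTwist_slice_right {c : Piece} (hc : c.IsCrossing) (p : Piece) (n : ℕ) :
    TangleIso (n + p.inputs) (n + p.outputs) (halfTwist c (n + p.inputs) ++ [⟨p, n⟩])
      (⟨p, 0⟩ :: halfTwist c (n + p.outputs)) := by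
  have hn := isTangle_halfTwist hc n
  have comm := (interchange hn (isTangle_slice p 0 0)).symm
  have dbl : TangleIso (n + 2) (n + 2) (halfTwist c (n + 2)) (⟨c, 0⟩ :: doublePass c n ++ halfTwist c n) := by
    simpa [halfTwist] using (pass_pass hc n).append_right (hn.widen 2)
  have cross : ∀ p : Piece, p.IsCrossing → TangleIso (n + 2) (n + 2)
      (halfTwist c (n + 2) ++ [⟨p, n⟩]) (⟨p, 0⟩ :: halfTwist c (n + 2)) := by
    intro p hp
    have h0 := dbl.append_right (isTangle_crossing (i := n) hp)
    have h1 := ((interchange hn (isTangle_crossing (i := 0) (n := 2) hp)).symm.cast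
      (k := n + 2) (l := n + 2)).append_left (A := ⟨c, 0⟩ :: doublePass c n) (k := n + 2)
      ((isTangle_crossing (i := 0) hc).append (isTangle_doublePass hc n))
    have h2 := ((doublePass_crossing hc hp n).append_left (isTangle_crossing (i := 0) hc)).append_right
      (hn.widen 2)
    have h3 : TangleIso (n + 2) (n + 2) [⟨c, 0⟩, ⟨p, 0⟩] [⟨p, 0⟩, ⟨c, 0⟩] := by
      have h : p = c ∨ p = c.mirror := by
        rcases hc with rfl | rfl <;> rcases hp with rfl | rfl <;> simp [Piece.mirror]
      rcases h with rfl | rfl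
      · exact .refl ((isTangle_crossing (i := 0) hp).append (isTangle_crossing (i := 0) hp))
      · exact ((crossing_cancel hc 0 n).trans (crossing_cancel' hc 0 n).symm).cast
    have h4 := h3.append_right ((isTangle_doublePass hc n).append (hn.widen 2))
    have h5 := dbl.append_left (isTangle_crossing (i := 0) hp)
    refine h0.trans ((TangleIso.of_eq h0.2 ?_).trans (h1.trans ((TangleIso.of_eq h1.2 ?_).trans
      (h2.trans ((TangleIso.of_eq h2.2 ?_).trans (h4.trans ((TangleIso.of_eq h4.2 ?_).trans
      h5.symm)))))))
    · simp [shift]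
    · simp [shift]
    · simp
    · simp
  cases p with
  | cap =>
    have h1 := (doublePass_cap hc n).append_right (hn.widen 2)
    have h2 := dbl.append_left (A := [⟨.cap, 0⟩]) (k := n)
      (by simp [IsTangle, Piece.inputs, Piece.outputs])
    have h3 : TangleIso n (n + 2) [⟨.cap, 0⟩, ⟨c, 0⟩] [⟨.cap, 0⟩] :=
      .of_move (.reidemeisterOneCap c hc 0)
        (by simp [IsTangle, hc.inputs, hc.outputs]; simp [Piece.inputs, Piece.outputs])
        (by simp [IsTangle, Piece.inputs, Piece.outputs])
    have h4 := h3.append_right ((isTangle_doublePass hc n).append (hn.widen 2))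
    have h5 := comm.trans ((TangleIso.of_eq comm.2 ?_).trans (h1.symm.trans
      ((TangleIso.of_eq h1.1 ?_).trans (h4.symm.trans ((TangleIso.of_eq h4.1 ?_).trans h2.symm)))))
    · simpa [shift, Piece.inputs, Piece.outputs] using h5
    · simp [shift]
    · simp
    · simp
  | cup =>
    have h0 := dbl.append_right (B := [⟨.cup, n⟩]) (l := n)
      (by simp [IsTangle, Piece.inputs, Piece.outputs])
    have comm' : TangleIso (n + 2) n _ _ := comm
    have h1 := comm'.append_left (A := ⟨c, 0⟩ :: doublePass c n)
      (k := n + 2) ((isTangle_crossing (i := 0) hc).append (isTangle_doublePass hc n))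
    have h2 := ((doublePass_cup hc n).append_left (isTangle_crossing (i := 0) hc)).append_right hn
    have h3 : TangleIso (n + 2) n [⟨c, 0⟩, ⟨.cup, 0⟩] [⟨.cup, 0⟩] :=
      .of_move (.reidemeisterOneCup c hc 0)
        (by simp [IsTangle, hc.inputs, hc.outputs]; simp [Piece.inputs, Piece.outputs])
        (by simp [IsTangle, Piece.inputs, Piece.outputs])
    have h4 := h3.append_right hn
    have h5 := h0.trans ((TangleIso.of_eq h0.2 ?_).trans (h1.trans ((TangleIso.of_eq h1.2 ?_).trans
      (h2.trans ((TangleIso.of_eq h2.2 ?_).trans h4)))))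
    · simpa [Piece.inputs, Piece.outputs] using h5
    · simp [shift]
    · simp [shift]
    · simp
  | pos => exact cross _ (Or.inl rfl)
  | neg => exact cross _ (Or.inr rfl)

/-- Induction on the number of strands to the right of the piece: the strand of the first pass ends
at the far right, so after the smaller half twist has been crossed only `pass_slice` is needed. -/
theorem halfTwist_slice {c : Piece} (hc : c.IsCrossing) (p : Piece) (i k : ℕ) :
    TangleIso (i + p.inputs + k) (i + p.outputs + k) (halfTwist c (i + p.inputs + k) ++ [⟨p, i⟩])
      (⟨p, k⟩ :: halfTwist c (i + p.outputs + k)) := by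
  induction k with
  | zero => exact halfTwist_slice_right hc p i
  | succ k ih =>
    have h1 := (ih.widen 1).append_left (isTangle_pass hc (i + p.inputs + k))
    have h2 := ((pass_slice hc p k i).cast (k := i + p.inputs + k + 1)
      (l := i + p.outputs + k + 1)).append_right ((isTangle_halfTwist hc (i + p.outputs + k)).widen 1)
    refine (TangleIso.of_eq ?_ ?_).trans (h1.trans ((TangleIso.of_eq h1.2 ?_).trans
      (h2.trans (.of_eq h2.2 ?_))))
    · exact (isTangle_halfTwist hc (i + p.inputs + k + 1)).append
        ((isTangle_slice p i (k + 1)).cast)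
    · simp [halfTwist]
    · simp [Nat.add_comm, Nat.add_left_comm]
    · simp [halfTwist, ← Nat.add_assoc, Nat.add_comm]

/-- A half twist may be moved through a tangle, which is thereby rotated. -/
theorem halfTwist_append {c : Piece} (hc : c.IsCrossing) {n m : ℕ} {T : Diagram}
    (hT : IsTangle n T m) :
    TangleIso n m (halfTwist c n ++ T) (rotate n T ++ halfTwist c m) := by
  induction T generalizing n with
  | nil =>
    obtain rfl : n = m := hT
    simpa [rotate] using TangleIso.refl (isTangle_halfTwist hc n)
  | cons s T ih =>
    obtain ⟨p, i⟩ := s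
    obtain ⟨k, hk⟩ := Nat.exists_eq_add_of_le hT.1
    simp only at hk
    subst hk
    have hT2 := hT.2
    simp only at hT2
    have e : i + p.inputs + k - p.inputs + p.outputs = i + p.outputs + k := by omega
    have e' : i + p.inputs + k - p.inputs - i = k := by omega
    rw [e] at hT2
    have h1 := (halfTwist_slice hc p i k).append_right hT2
    have h2 := (ih hT2).append_left (A := [⟨p, k⟩]) (k := i + p.inputs + k)
      ((isTangle_slice p k i).cast)
    simpa [rotate, e, e'] using h1.trans (by simpa using h2)

/-- A link diagram is isotopic to its image under the rotation about the vertical axis. -/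
theorem TangleIso.rotate {D : Diagram} (h : IsTangle 0 D 0) : TangleIso 0 0 D (rotate 0 D) := by
  simpa [halfTwist] using halfTwist_append (c := .pos) (Or.inl rfl) h

/-! ### Isotopies given by lists of moves -/

/-- The number of strands at the bottom of a tangle diagram with `n` top end points. -/
def width : ℕ → Diagram → Option ℕ
  | n, [] => some n
  | n, s :: D =>
      if s.left + s.piece.inputs ≤ n then width (n - s.piece.inputs + s.piece.outputs) D else none

theorem width_eq_some {n m : ℕ} {D : Diagram} : width n D = some m ↔ IsTangle n D m := by
  induction D generalizing n with
  | nil => simp [width, IsTangle]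
  | cons s D ih => simp [width, IsTangle, ih]

instance : DecidableEq Piece := fun p q => by
  cases p <;> cases q <;> first | exact isTrue rfl | exact isFalse (by intro h; cases h)

instance : DecidableEq Slice := fun s t =>
  if hp : s.piece = t.piece then
    if hl : s.left = t.left then isTrue (by cases s; cases t; simp_all)
    else isFalse fun h => hl (h ▸ rfl)
  else isFalse fun h => hp (h ▸ rfl)

/-- The local moves, and the variants of the third Reidemeister move for crossings of mixed type. -/
inductive Rule
  | zigzagLeft
  | zigzagRight
  | oneCap (neg : Bool)
  | oneCup (neg : Bool)
  | two (neg : Bool)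
  | slideCap (neg : Bool)
  | slideCup (neg : Bool)
  | threeUp (neg neg' : Bool)
  | threeDown (neg neg' : Bool)

/-- A crossing of the given type. -/
def crossing (neg : Bool) : Piece := if neg then .neg else .pos

theorem isCrossing_crossing (b : Bool) : (crossing b).IsCrossing := by
  cases b
  · exact Or.inl rfl
  · exact Or.inr rfl

/-- The two sides of a local move. -/
def Rule.sides (i : ℕ) : Rule → Diagram × Diagram
  | zigzagLeft => ([⟨.cap, i⟩, ⟨.cup, i + 1⟩], [])
  | zigzagRight => ([⟨.cap, i + 1⟩, ⟨.cup, i⟩], [])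
  | oneCap b => ([⟨.cap, i⟩, ⟨crossing b, i⟩], [⟨.cap, i⟩])
  | oneCup b => ([⟨crossing b, i⟩, ⟨.cup, i⟩], [⟨.cup, i⟩])
  | two b => ([⟨crossing b, i⟩, ⟨(crossing b).mirror, i⟩], [])
  | slideCap b => ([⟨.cap, i⟩, ⟨crossing b, i + 1⟩], [⟨.cap, i + 1⟩, ⟨(crossing b).mirror, i⟩])
  | slideCup b => ([⟨crossing b, i + 1⟩, ⟨.cup, i⟩], [⟨(crossing b).mirror, i⟩, ⟨.cup, i + 1⟩])
  | threeUp b b' => ([⟨crossing b, i⟩, ⟨crossing b, i + 1⟩, ⟨crossing b', i⟩],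
      [⟨crossing b', i + 1⟩, ⟨crossing b, i⟩, ⟨crossing b, i + 1⟩])
  | threeDown b b' => ([⟨crossing b, i + 1⟩, ⟨crossing b, i⟩, ⟨crossing b', i + 1⟩],
      [⟨crossing b', i⟩, ⟨crossing b, i + 1⟩, ⟨crossing b, i⟩])

theorem Rule.tangleIso (r : Rule) {i n m : ℕ} (hl : IsTangle n (r.sides i).1 m)
    (hr : IsTangle n (r.sides i).2 m) : TangleIso n m (r.sides i).1 (r.sides i).2 := by
  have three : ∀ {x y z : Slice} {E : Diagram}, i + 3 ≤ n → n = m →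
      TangleIso 3 3 [x, y, z] E → TangleIso n m (shift i [x, y, z]) (shift i E) := by
    rintro x y z E h rfl e
    exact ((e.shift i).widen (n - (3 + i))).cast
  cases r with
  | zigzagLeft => exact .of_move (.zigzagLeft i) hl hr
  | zigzagRight => exact .of_move (.zigzagRight i) hl hr
  | oneCap b => exact .of_move (.reidemeisterOneCap _ (isCrossing_crossing b) i) hl hr
  | oneCup b => exact .of_move (.reidemeisterOneCup _ (isCrossing_crossing b) i) hl hr
  | two b => exact .of_move (.reidemeisterTwo _ (isCrossing_crossing b) i) hl hr
  | slideCap b => exact .of_move (.slideCap _ (isCrossing_crossing b) i) hl hr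
  | slideCup b => exact .of_move (.slideCup _ (isCrossing_crossing b) i) hl hr
  | threeUp b b' =>
    have e := reidemeisterThree_up (isCrossing_crossing b) (isCrossing_crossing b')
    have h := hl
    simp only [sides, IsTangle, (isCrossing_crossing b).inputs, (isCrossing_crossing b).outputs,
      (isCrossing_crossing b').inputs, (isCrossing_crossing b').outputs] at h
    simpa [shift, sides, Nat.add_comm] using three (by omega) (by omega) e
  | threeDown b b' =>
    have e := reidemeisterThree_down (isCrossing_crossing b) (isCrossing_crossing b')
    have h := hl
    simp only [sides, IsTangle, (isCrossing_crossing b).inputs, (isCrossing_crossing b).outputs,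
      (isCrossing_crossing b').inputs, (isCrossing_crossing b').outputs] at h
    simpa [shift, sides, Nat.add_comm] using three (by omega) (by omega) e

/-! ### Sound operations as certificates for isotopies -/

/-- Operations on diagrams with a given number of top end points that preserve isotopy classes. -/
def IsSound (f : ℕ → Diagram → Diagram) : Prop :=
  ∀ n m D, IsTangle n D m → TangleIso n m D (f n D)

/-- Replace an initial piece `l` of a diagram by `r`. -/
def replaceHead (l r : Diagram) (n : ℕ) (D : Diagram) : Diagram :=
  -- The comparison of widths ensures that `r` fits at this place. When `l` is empty it is the only
  -- condition, and it keeps inserted pairs within the available strands.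
  if D.take l.length = l ∧ width n l = width n r then r ++ D.drop l.length else D

theorem isSound_replaceHead {l r : Diagram}
    (h : ∀ n m, IsTangle n l m → IsTangle n r m → TangleIso n m l r) :
    IsSound (replaceHead l r) := by
  intro n m D hD
  unfold replaceHead
  split_ifs with hc
  · obtain ⟨h1, h2⟩ := hc
    rw [← List.take_append_drop l.length D, h1] at hD
    obtain ⟨k, hk, hk'⟩ := isTangle_append.1 hD
    have := (h n k hk (width_eq_some.1 (h2 ▸ width_eq_some.2 hk))).append_right hk'
    have e : l ++ D.drop l.length = D := by
      conv_rhs => rw [← List.take_append_drop l.length D, h1]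
    rwa [e] at this
  · exact .refl hD

/-- Exchange the first two slices if they are distant; a slice that can be moved to either side is
regarded as lying to the right if `b` holds. -/
def exchangeHead (b : Bool) (_ : ℕ) : Diagram → Diagram
  | s :: t :: D =>
      if b ∧ s.left + s.piece.outputs ≤ t.left then
        ⟨t.piece, t.left - s.piece.outputs + s.piece.inputs⟩ :: s :: D
      else if t.left + t.piece.inputs ≤ s.left then
        t :: ⟨s.piece, s.left - t.piece.inputs + t.piece.outputs⟩ :: D
      else s :: t :: D
  | D => D

theorem isSound_exchangeHead (b : Bool) : IsSound (exchangeHead b) := by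
  intro n m D hD
  match D with
  | [] => exact .refl hD
  | [s] => exact .refl hD
  | s :: t :: D =>
    have h1 := hD.1
    have h2 := hD.2.1
    simp only [exchangeHead]
    split_ifs with hc hc'
    · have h := slice_exchange s ⟨t.piece, t.left - (s.left + s.piece.outputs)⟩
        (s.left + s.piece.inputs) (n - (s.left + s.piece.inputs)) le_rfl (by simp only; omega)
      simp only at h
      rw [show t.left - (s.left + s.piece.outputs) + (s.left + s.piece.inputs)
          = t.left - s.piece.outputs + s.piece.inputs by omega,
        show t.left - (s.left + s.piece.outputs)
          + (s.left + s.piece.inputs - s.piece.inputs + s.piece.outputs) = t.left by omega] at h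
      exact (h.symm.cast (k := n)
        (l := n - s.piece.inputs + s.piece.outputs - t.piece.inputs + t.piece.outputs)).append_right
        hD.2.2
    · have h := slice_exchange t ⟨s.piece, s.left - (t.left + t.piece.inputs)⟩
        (t.left + t.piece.inputs) (n - (t.left + t.piece.inputs)) le_rfl (by simp only; omega)
      simp only at h
      rw [show s.left - (t.left + t.piece.inputs) + (t.left + t.piece.inputs) = s.left by omega,
        show s.left - (t.left + t.piece.inputs)
          + (t.left + t.piece.inputs - t.piece.inputs + t.piece.outputs)
          = s.left - t.piece.inputs + t.piece.outputs by omega] at h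
      exact (h.cast (k := n)
        (l := n - s.piece.inputs + s.piece.outputs - t.piece.inputs + t.piece.outputs)).append_right
        hD.2.2
    · exact .refl hD

/-- Apply an operation below the first `t` slices. -/
def applyAt (f : ℕ → Diagram → Diagram) : ℕ → ℕ → Diagram → Diagram
  | 0, n, D => f n D
  | _ + 1, _, [] => []
  | t + 1, n, s :: D => s :: applyAt f t (n - s.piece.inputs + s.piece.outputs) D

theorem IsSound.applyAt {f : ℕ → Diagram → Diagram} (hf : IsSound f) (t : ℕ) :
    IsSound (applyAt f t) := by
  induction t with
  | zero => exact hf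
  | succ t ih =>
    intro n m D hD
    match D with
    | [] => exact .refl hD
    | s :: D =>
      exact (ih _ _ _ hD.2).append_left (A := [s]) ⟨hD.1, rfl⟩

theorem IsSound.comp {f g : ℕ → Diagram → Diagram} (hf : IsSound f) (hg : IsSound g) :
    IsSound fun n D => g n (f n D) := fun n m D hD =>
  (hf n m D hD).trans (hg n m _ (hf n m D hD).2)

/-- The slice number `a` is moved down by `k` places. -/
def slideDown (a : ℕ) : ℕ → ℕ → Diagram → Diagram
  | 0, _, D => D
  | k + 1, n, D => slideDown (a + 1) k n (applyAt (exchangeHead true) a n D)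

theorem isSound_slideDown (k : ℕ) : ∀ a, IsSound (slideDown a k) := by
  induction k with
  | zero => exact fun a n m D hD => .refl hD
  | succ k ih => exact fun a => ((isSound_exchangeHead true).applyAt a).comp (ih (a + 1))

/-- The slice number `b + k` is moved up by `k` places. -/
def slideUp (b : ℕ) : ℕ → ℕ → Diagram → Diagram
  | 0, _, D => D
  | k + 1, n, D => slideUp b k n (applyAt (exchangeHead true) (b + k) n D)

theorem isSound_slideUp (b k : ℕ) : IsSound (slideUp b k) := by
  induction k with
  | zero => exact fun n m D hD => .refl hD
  | succ k ih => exact ((isSound_exchangeHead true).applyAt (b + k)).comp ih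

/-- An outermost arc may be moved from one side of a diagram to the other. -/
theorem TangleIso.swing {T : Diagram} (hT : IsTangle 1 T 1) :
    TangleIso 0 0 ([⟨.cap, 0⟩] ++ SlicedDiagram.shift 1 T ++ [⟨.cup, 0⟩]) ([⟨.cap, 0⟩] ++ T ++ [⟨.cup, 0⟩]) := by
  -- The half twist of a single strand is empty, so pushing it through `T` costs nothing and rotates
  -- `T`.
  have h1 : TangleIso 1 1 T (SlicedDiagram.rotate 1 T) := by
    simpa [halfTwist, pass] using halfTwist_append (c := .pos) (Or.inl rfl) hT
  have h2 := ((h1.shift 1).append_left (A := [⟨.cap, 0⟩]) (k := 0) (by decide)).append_right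
    (B := [⟨.cup, 0⟩]) (l := 0) (by decide)
  have h3 : IsTangle 0 ([⟨.cap, 0⟩] ++ T ++ [⟨.cup, 0⟩]) 0 :=
    (IsTangle.append (k := 2) (by decide) (hT.widen 1)).append (by decide)
  have e : SlicedDiagram.rotate 2 T = SlicedDiagram.shift 1 (SlicedDiagram.rotate 1 T) := by
    simpa [shift_zero] using rotate_shift hT 0 1
  have h4 := TangleIso.rotate h3
  rw [rotate_append (k := 2) (IsTangle.append (k := 2) (by decide) (hT.widen 1)),
    rotate_append (k := 2) (by decide), e] at h4
  exact h2.trans h4.symm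

/-- Rotate a link diagram in its plane. -/
def turnLink (n : ℕ) (D : Diagram) : Diagram :=
  if n = 0 ∧ IsTangle 0 D 0 then halfTurn 0 D else D

theorem isSound_turnLink : IsSound turnLink := by
  intro n m D hD
  unfold turnLink
  split_ifs with h
  · obtain ⟨rfl, h⟩ := h
    obtain rfl := h.unique hD
    exact .halfTurn h
  · exact .refl hD

/-- Move an outermost arc of a link diagram from the right to the left. -/
def swingArc (n : ℕ) (D : Diagram) : Diagram :=
  if n = 0 ∧ IsTangle 1 D.tail.dropLast 1 ∧ D = [⟨.cap, 0⟩] ++ D.tail.dropLast ++ [⟨.cup, 0⟩] then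
    [⟨.cap, 0⟩] ++ shift 1 D.tail.dropLast ++ [⟨.cup, 0⟩]
  else D

theorem isSound_swingArc : IsSound swingArc := by
  intro n m D hD
  unfold swingArc
  split_ifs with h
  · obtain ⟨rfl, h, e⟩ := h
    have hs := TangleIso.swing h
    rw [← e] at hs
    obtain rfl := hs.2.unique hD
    exact hs.symm
  · exact .refl hD

/-- One step of an isotopy. -/
inductive Op
  /-- move the slice number `a` to the place number `b` -/
  | slide (a b : ℕ)
  /-- exchange the slice number `t` with the next one, which lies to its left -/
  | exchange (t : ℕ)
  /-- apply a local move below the first `t` slices, with `i` strands to its left -/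
  | rule (t : ℕ) (r : Rule) (i : ℕ)
  /-- apply the inverse of a local move -/
  | inv (t : ℕ) (r : Rule) (i : ℕ)
  /-- rotate a link diagram in its plane by the angle `π` -/
  | turn
  /-- move an outermost arc of a link diagram from the right to the left -/
  | swing

/-- The result of a step. -/
def Op.run : Op → ℕ → Diagram → Diagram
  | slide a b, n, D => slideUp b (a - b) n (slideDown a (b - a) n D)
  | exchange t, n, D => applyAt (exchangeHead false) t n D
  | rule t r i, n, D => applyAt (replaceHead (r.sides i).1 (r.sides i).2) t n D
  | inv t r i, n, D => applyAt (replaceHead (r.sides i).2 (r.sides i).1) t n D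
  | turn, n, D => turnLink n D
  | swing, n, D => swingArc n D

theorem Op.isSound_run (o : Op) : IsSound o.run := by
  cases o with
  | slide a b => exact (isSound_slideDown (b - a) a).comp (isSound_slideUp b (a - b))
  | exchange t => exact (isSound_exchangeHead false).applyAt t
  | rule t r i => exact (isSound_replaceHead fun n m hl hr => r.tangleIso hl hr).applyAt t
  | inv t r i => exact (isSound_replaceHead fun n m hl hr => (r.tangleIso hr hl).symm).applyAt t
  | turn => exact isSound_turnLink
  | swing => exact isSound_swingArc

/-- Each operation yields an isotopic diagram whether or not the intended move applies, so no side
conditions arise along the way: it suffices to evaluate the list and compare the result with `E`. -/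
theorem TangleIso.of_ops {n m : ℕ} {D E : Diagram} (ops : List Op)
    (h : IsTangle n D m ∧ ops.foldl (fun X o => o.run n X) D = E) : TangleIso n m D E := by
  obtain ⟨hD, rfl⟩ := h
  induction ops generalizing D with
  | nil => exact .refl hD
  | cons o ops ih =>
    have := o.isSound_run n m D hD
    exact this.trans (ih this.2)

/-! ### Chirally cosmetic bands -/

/-- The part of `knotOf R` between the two boxes. -/
def knotMiddle : Diagram :=
  [⟨.cap, 2⟩, ⟨.pos, 1⟩, ⟨.pos, 3⟩, ⟨.cap, 3⟩, ⟨.neg, 4⟩, ⟨.cup, 3⟩, ⟨.pos, 0⟩, ⟨.neg, 1⟩, ⟨.pos, 4⟩,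
    ⟨.neg, 3⟩, ⟨.cup, 2⟩, ⟨.pos, 1⟩]

/-- The part between the two boxes after the surgery. -/
def surgeryMiddle : Diagram :=
  [⟨.cap, 2⟩, ⟨.pos, 1⟩, ⟨.pos, 3⟩, ⟨.cap, 3⟩, ⟨.cup, 2⟩, ⟨.cap, 2⟩, ⟨.neg, 4⟩, ⟨.cup, 3⟩, ⟨.pos, 0⟩,
    ⟨.neg, 1⟩, ⟨.pos, 4⟩, ⟨.neg, 3⟩, ⟨.cup, 2⟩, ⟨.pos, 1⟩]

/-- The only computation in which the shape of the band enters, and it holds relative to the eight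
end points, hence for every choice of the boxes. The half twist at the bottom is the one that will
rotate the lower box back. -/
theorem halfTurn_surgeryMiddle :
    TangleIso 4 4 (halfTurn 4 surgeryMiddle ++ halfTwist .neg 4) (mirror knotMiddle) :=
  .of_ops
      [.slide 8 7, .rule 6 .zigzagLeft 3, .rule 7 .zigzagRight 3, .inv 1 (.slideCap false) 1,
      .slide 1 0, .slide 3 1, .rule 2 (.threeDown false true) 2, .slide 5 4, .rule 5 (.two false)
      2, .slide 2 1, .rule 0 (.slideCap true) 1, .slide 3 1, .slide 4 2, .rule 3 (.threeDown false
      false) 0, .slide 6 5, .slide 7 6, .rule 7 (.two false) 0, .slide 3 1, .slide 4 2, .inv 3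
      (.threeDown false false) 3, .slide 6 5, .inv 6 (.threeUp true false) 1, .inv 8 (.threeUp
      true false) 0, .rule 10 (.two false) 0, .slide 3 2, .slide 4 3, .inv 4 (.slideCup true) 1,
      .slide 6 5, .inv 3 (.threeUp true false) 2, .slide 1 0, .slide 2 1, .rule 2 (.oneCap true)
      2, .slide 2 1, .slide 6 4, .inv 2 (.threeUp true false) 3, .rule 5 (.slideCup false) 1,
      .slide 1 0, .slide 2 1, .slide 3 2, .slide 4 3, .slide 7 6, .inv 4 (.threeDown true false)
      0, .inv 2 .zigzagRight 3, .inv 3 (.oneCup true) 3, .inv 2 (.slideCap false) 3, .slide 7 1,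
      .slide 8 6, .slide 9 7]
    (by decide +kernel)

/-- Two strands around a box, the box being closed off below. -/
theorem halfTwist_close {F : Diagram} (hF : IsTangle 2 F 2) :
    TangleIso 4 0 (shift 1 (rotate 2 F) ++ [⟨.cup, 0⟩, ⟨.cup, 0⟩])
      (halfTwist .neg 4 ++ (shift 1 F ++ [⟨.cup, 0⟩, ⟨.cup, 0⟩])) := by
  have hs : IsTangle 4 (shift 1 F) 4 := (hF.shift 1).widen 1
  -- The closed-off box has no lower end points, so the half twist that emerges below it is empty.
  have h1 := halfTwist_append (c := .neg) (Or.inr rfl)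
    (hs.append (show IsTangle 4 [⟨.cup, 0⟩, ⟨.cup, 0⟩] 0 by decide))
  have e : rotate 4 (shift 1 F) = shift 1 (rotate 2 F) := rotate_shift hF 1 1
  rw [rotate_append hs, e] at h1
  -- Rotation interchanges the two final minima, which costs one exchange of heights.
  have h2 : TangleIso 4 0 [⟨.cup, 0⟩, ⟨.cup, 0⟩] [⟨.cup, 2⟩, ⟨.cup, 0⟩] :=
    .of_ops [.slide 0 1] (by decide +kernel)
  have h3 := h2.append_left (e ▸ isTangle_rotate hs)
  refine h3.trans (.trans (.of_eq h3.2 ?_) h1.symm)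
  simp [rotate, halfTwist, Piece.inputs, Piece.outputs]

theorem surgery_isotopic {R : Diagram} (hR : IsSymmetricTangle R) :
    TangleIso 0 0 (bandSurgery (aboveBand R) 2 (belowBand R)) (mirror (knotOf R)) := by
  obtain ⟨hT, hsym⟩ := hR
  have hU := hT.upsideDown
  have caps : IsTangle 0 [⟨.cap, 0⟩, ⟨.cap, 2⟩] 4 := by decide
  have cups : IsTangle 4 [⟨.cup, 0⟩, ⟨.cup, 0⟩] 0 := by decide
  have box : ∀ {X : Diagram}, IsTangle 2 X 2 → IsTangle 4 (shift 1 X) 4 := fun h =>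
    (h.shift 1).widen 1
  have middle : IsTangle 4 surgeryMiddle 4 := by decide
  have e0 : bandSurgery (aboveBand R) 2 (belowBand R) = [⟨.cap, 0⟩, ⟨.cap, 2⟩] ++ (shift 1 R ++
      (surgeryMiddle ++ (shift 1 (upsideDown R) ++ [⟨.cup, 0⟩, ⟨.cup, 0⟩]))) := by
    simp [bandSurgery, aboveBand, belowBand, surgeryMiddle]
  have e1 : mirror (knotOf R) = [⟨.cap, 0⟩, ⟨.cap, 2⟩] ++ (shift 1 (mirror R) ++
      (mirror knotMiddle ++ (shift 1 (mirror (upsideDown R)) ++ [⟨.cup, 0⟩, ⟨.cup, 0⟩]))) := by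
    simp [knotOf, aboveBand, belowBand, knotMiddle, ← mirror_shift]
    simp [mirror, Piece.mirror]
  have hS : IsTangle 0 (bandSurgery (aboveBand R) 2 (belowBand R)) 0 := by
    rw [e0]
    exact caps.append ((box hT).append (middle.append ((box hU).append cups)))
  have t1 := TangleIso.halfTurn hS
  have e2 : halfTurn 0 (bandSurgery (aboveBand R) 2 (belowBand R)) = [⟨.cap, 0⟩, ⟨.cap, 2⟩] ++
      (shift 1 (mirror (rotate 2 R)) ++ (halfTurn 4 surgeryMiddle ++
        (shift 1 (rotate 2 (mirror (upsideDown R))) ++ [⟨.cup, 0⟩, ⟨.cup, 0⟩]))) := by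
    have b1 : halfTurn 4 (shift 1 R) = shift 1 (halfTurn 2 R) := halfTurn_shift hT 1 1
    have b2 : halfTurn 4 (shift 1 (upsideDown R)) = shift 1 (halfTurn 2 (upsideDown R)) :=
      halfTurn_shift hU 1 1
    -- The half turn swaps the boxes. Each image is written as a rotation of, or the mirror image of
    -- a rotation of, the box that `mirror (knotOf R)` has at the same place.
    have b3 : halfTurn 2 R = rotate 2 (mirror (upsideDown R)) := by
      rw [rotate_mirror, rotate_upsideDown hT, halfTurn]
    have b4 : halfTurn 2 (upsideDown R) = mirror (rotate 2 R) := by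
      rw [halfTurn, rotate_upsideDown hT, upsideDown_upsideDown]
    have b5 : halfTurn 0 [⟨.cap, 0⟩, ⟨.cap, 2⟩] = [⟨.cup, 0⟩, ⟨.cup, 0⟩] := by decide
    have b6 : halfTurn 4 [⟨.cup, 0⟩, ⟨.cup, 0⟩] = [⟨.cap, 0⟩, ⟨.cap, 2⟩] := by decide
    rw [e0, halfTurn_append caps, halfTurn_append (box hT), halfTurn_append middle,
      halfTurn_append (box hU), b1, b2, b3, b4, b5, b6]
    simp only [List.append_assoc]
  rw [e2] at t1
  -- The only place where the symmetry of `R` is used; the rotation of the lower box is undone by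
  -- the half twist instead.
  have top : TangleIso 2 2 (mirror (rotate 2 R)) (mirror R) :=
    (TangleIso.of_isotopic hsym hT).symm.mirror
  have hF : IsTangle 2 (mirror (upsideDown R)) 2 := hU.mirror
  have t2 := (halfTwist_close hF).append_left middle.halfTurn
  have t3 := halfTurn_surgeryMiddle.append_right ((box hF).append cups)
  have t4 := t2.trans (.trans (.of_eq t2.2 (by simp)) t3)
  have t5 := (((top.shift 1).widen 1).append t4).append_left caps
  rw [e1]
  exact t1.trans t5

/-! ### The knots `5₁`, `7₃` and `8₈` -/

theorem isSymmetricTangle_oneHalfTwist : IsSymmetricTangle oneHalfTwist :=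
  ⟨by decide, Relation.EqvGen.refl _⟩

theorem isSymmetricTangle_threeHalfTwists : IsSymmetricTangle threeHalfTwists :=
  ⟨by decide, (TangleIso.of_ops (n := 2) (m := 2)
      [.slide 0 1, .slide 2 3, .slide 5 2, .slide 6 4]
    (by decide +kernel)).isotopic⟩

theorem isSymmetricTangle_threeCrossingTangle : IsSymmetricTangle threeCrossingTangle :=
  ⟨by decide, (TangleIso.of_ops (n := 2) (m := 2)
      [.inv 3 .zigzagLeft 2, .inv 4 (.two true) 2, .rule 3 (.oneCap true) 2, .inv 0 (.slideCap
      false) 0, .inv 4 (.slideCup true) 2, .slide 3 2, .slide 6 5, .rule 3 (.threeDown true true)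
      3, .rule 2 (.slideCap true) 2, .rule 5 (.slideCup true) 2, .slide 7 6, .rule 5 (.slideCup
      false) 1, .slide 2 1, .slide 4 2, .rule 3 (.threeUp false true) 1, .slide 1 0, .slide 2 1,
      .slide 3 2, .rule 3 (.slideCap false) 0, .inv 6 (.oneCup true) 2, .rule 5 (.two false) 2,
      .slide 5 4, .rule 3 .zigzagLeft 1]
    (by decide +kernel)).isotopic⟩

theorem knotOf_oneHalfTwist : LinkIsotopic (knotOf oneHalfTwist) knotFiveOne :=
  (TangleIso.of_ops (n := 0) (m := 0)
      [.rule 6 (.slideCap true) 3, .rule 7 (.oneCup false) 3, .rule 6 .zigzagRight 3, .slide 1 0,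
      .rule 1 (.slideCap true) 0, .slide 3 2, .slide 5 3, .inv 4 (.threeDown false false) 0, .rule
      6 (.two false) 1, .slide 4 3, .inv 2 (.slideCap true) 1, .rule 7 (.slideCup true) 2, .slide
      5 3, .slide 7 6, .inv 4 (.threeDown false true) 2, .slide 2 1, .slide 3 2, .rule 3 (.oneCap
      false) 3, .slide 3 1, .slide 4 3, .rule 2 (.slideCap false) 1, .slide 5 3, .rule 2
      (.slideCap true) 2, .slide 2 1, .rule 2 (.slideCap false) 1, .slide 6 2, .slide 7 4, .rule 3
      .zigzagLeft 2, .rule 1 (.slideCap false) 1, .inv 4 (.threeUp false true) 0, .inv 3 (.threeUp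
      false true) 0, .inv 2 (.threeUp false true) 0, .slide 1 0, .rule 1 (.oneCap false) 0, .rule
      6 (.slideCup false) 0, .rule 1 (.slideCap false) 0]
    (by decide +kernel)).isotopic

theorem knotOf_threeHalfTwists :
    LinkIsotopic (knotOf threeHalfTwists) (mirror knotSevenThree) :=
  (TangleIso.of_ops (n := 0) (m := 0)
      [.slide 1 0, .slide 2 1, .slide 3 2, .rule 3 (.slideCap true) 0, .slide 5 3, .slide 6 5,
      .rule 4 .zigzagLeft 1, .rule 2 (.slideCap true) 0, .slide 5 2, .slide 6 4, .rule 3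
      .zigzagLeft 1, .slide 5 4, .slide 7 5, .slide 8 6, .slide 9 7, .slide 10 8, .inv 9
      (.threeDown false false) 0, .rule 11 (.two false) 1, .rule 6 (.slideCap true) 3, .rule 7
      (.oneCup false) 3, .rule 6 .zigzagRight 3, .slide 16 15, .inv 14 (.slideCap true) 1, .slide
      19 15, .rule 14 .zigzagRight 0, .slide 14 12, .slide 15 14, .inv 13 (.slideCap true) 1,
      .slide 16 14, .rule 13 .zigzagRight 0, .slide 1 0, .inv 1 (.slideCap false) 1, .slide 3 2,
      .slide 4 3, .slide 6 4, .slide 7 5, .rule 6 (.threeDown false false) 3, .rule 8 (.two false)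
      3, .inv 1 (.slideCap true) 0, .inv 3 (.slideCap true) 1, .slide 3 2, .slide 5 3, .rule 4
      (.threeDown true false) 2, .slide 7 6, .rule 7 (.oneCup true) 2, .slide 1 0, .slide 2 1,
      .slide 3 2, .slide 4 3, .inv 4 (.slideCap false) 3, .slide 7 5, .rule 4 .zigzagRight 2,
      .slide 3 2, .slide 4 3, .slide 5 4, .rule 5 (.threeUp false true) 0, .rule 6 (.threeUp false
      true) 0, .rule 9 (.slideCup false) 0, .rule 7 (.threeUp false true) 0, .rule 9 (.oneCup
      false) 1, .rule 1 (.slideCap false) 1, .inv 8 (.slideCup true) 0, .turn, .inv 1 .zigzagLeft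
      1, .exchange 2, .slide 3 12, .swing, .slide 1 0, .slide 2 1, .slide 3 2, .slide 4 3, .slide
      5 4, .slide 6 5, .rule 6 (.slideCap false) 0, .inv 10 (.oneCup true) 1, .inv 8 (.threeDown
      true false) 1, .rule 10 (.slideCup false) 1, .slide 8 7, .rule 6 (.slideCap true) 1, .inv 7
      (.threeUp true false) 0, .slide 6 2]
    (by decide +kernel)).isotopic

theorem knotOf_threeCrossingTangle : LinkIsotopic (knotOf threeCrossingTangle) knotEightEight :=
  (TangleIso.of_ops (n := 0) (m := 0)
      [.slide 1 0, .slide 2 1, .rule 2 (.slideCap true) 0, .slide 4 2, .slide 5 3, .slide 6 5,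
      .rule 4 .zigzagLeft 1, .slide 5 4, .slide 7 5, .slide 8 6, .slide 9 7, .slide 10 8, .inv 9
      (.threeDown false false) 0, .rule 11 (.two false) 1, .rule 6 (.slideCap true) 3, .rule 7
      (.oneCup false) 3, .rule 6 .zigzagRight 3, .slide 15 13, .inv 12 (.slideCap true) 1, .slide
      17 13, .rule 12 .zigzagRight 0, .slide 6 5, .inv 4 (.slideCap true) 1, .slide 4 3, .rule 4
      (.threeDown true false) 2, .rule 9 (.slideCup true) 2, .slide 7 6, .slide 8 7, .rule 8 (.two
      true) 2, .rule 1 (.slideCap true) 0, .rule 3 (.slideCap false) 1, .slide 5 4, .rule 3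
      (.slideCap true) 2, .slide 3 1, .slide 4 3, .rule 2 (.slideCap false) 1, .slide 7 2, .slide
      8 4, .rule 3 .zigzagLeft 2, .rule 6 (.threeUp false true) 0, .rule 10 (.slideCup false) 0,
      .inv 11 (.oneCup true) 1, .inv 9 (.threeUp true false) 0, .inv 8 (.threeUp true false) 0,
      .rule 7 (.two false) 0, .rule 1 (.slideCap false) 1, .slide 1 0, .swing, .slide 11 10, .rule
      9 (.slideCup false) 0, .inv 10 (.two true) 1, .rule 11 (.oneCup false) 1, .inv 8 (.threeUp
      true false) 0, .inv 10 (.slideCup true) 0, .slide 12 11, .inv 10 (.slideCup false) 1, .slide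
      8 7, .rule 8 (.threeDown true false) 1, .rule 10 (.oneCup true) 1, .rule 9 (.slideCup true)
      1, .slide 6 7, .inv 7 (.two false) 1, .rule 8 (.threeUp true false) 1, .rule 9 (.threeUp
      true false) 1, .rule 11 (.oneCup true) 2, .turn, .slide 1 0, .inv 1 (.slideCap false) 1,
      .slide 3 2, .inv 1 (.slideCap true) 0, .slide 1 0, .inv 1 (.slideCap false) 1, .slide 4 2,
      .inv 1 (.slideCap true) 0, .slide 1 0, .inv 1 (.slideCap false) 1, .inv 1 .zigzagLeft 1,
      .slide 2 14, .swing, .slide 1 0, .slide 2 1, .slide 3 2, .slide 4 3, .slide 5 4, .slide 6 5,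
      .slide 7 6, .rule 7 (.slideCap true) 0, .slide 9 8, .rule 7 (.slideCap false) 1, .inv 2
      .zigzagLeft 1, .slide 0 3, .exchange 2, .slide 3 16, .swing, .slide 1 0, .slide 2 1, .slide
      3 2, .slide 4 3, .slide 5 4, .rule 5 (.slideCap false) 0, .slide 7 6, .rule 5 (.slideCap
      true) 1, .slide 5 2, .slide 8 3]
    (by decide +kernel)).isotopic

/-! ### Colourings by involutory quandles -/

/-- An involutory quandle. -/
structure InvolutoryQuandle (X : Type*) where
  act : X → X → X
  act_self : ∀ a, act a a = a
  act_act : ∀ a b, act (act a b) b = a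
  act_distrib : ∀ a b c, act (act a b) c = act (act a c) (act b c)

theorem InvolutoryQuandle.act_bijective {X : Type*} (Q : InvolutoryQuandle X) (c : X) :
    Function.Bijective fun a => Q.act a c :=
  Function.Involutive.bijective fun a => Q.act_act a c

section Colouring

variable {X : Type*} [Fintype X] [DecidableEq X] (Q : InvolutoryQuandle X)

/-- The possible colours of the strands that leave a piece below, given the colours of those that
enter it above. -/
def pieceColourings : Piece → List X → Multiset (List X)
  | .cap, [] => Finset.univ.val.map fun a => [a, a]
  | .cup, [a, b] => if a = b then {[]} else 0
  | .pos, [a, b] => {[b, Q.act a b]}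
  | .neg, [a, b] => {[Q.act b a, a]}
  | _, _ => 0

/-- The number of colourings of a diagram with given colours of the top end points. -/
def numColourings : Diagram → List X → ℕ
  | [], _ => 1
  | s :: D, x => ((pieceColourings Q s.piece ((x.drop s.left).take s.piece.inputs)).map fun y =>
      numColourings D (x.take s.left ++ (y ++ x.drop (s.left + s.piece.inputs)))).sum

variable {Q}

theorem length_of_mem_pieceColourings {p : Piece} {v y : List X} (h : y ∈ pieceColourings Q p v) :
    y.length = p.outputs := by
  unfold pieceColourings at h
  split at h
  · obtain ⟨a, -, rfl⟩ := Multiset.mem_map.1 h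
    rfl
  · split_ifs at h
    · rw [Multiset.mem_singleton.1 h]; rfl
    · simp at h
  · rw [Multiset.mem_singleton.1 h]; rfl
  · rw [Multiset.mem_singleton.1 h]; rfl
  · simp at h

theorem numColourings_cons (p : Piece) {i : ℕ} (D : Diagram) {u v : List X} (w : List X)
    (hu : u.length = i) (hv : v.length = p.inputs) :
    numColourings Q (⟨p, i⟩ :: D) (u ++ (v ++ w)) =
      ((pieceColourings Q p v).map fun y => numColourings Q D (u ++ (y ++ w))).sum := by
  subst hu
  have h1 : (v ++ w).take p.inputs = v := by rw [← hv, List.take_left]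
  have h2 : (u ++ (v ++ w)).drop (u.length + p.inputs) = w := by
    rw [← hv, ← List.append_assoc, ← List.length_append, List.drop_left]
  simp only [numColourings, List.drop_left, List.take_left, h1, h2]

section pieces

variable {i : ℕ} (D : Diagram) {u : List X} (a b c : X) (w : List X)

theorem numColourings_cap (hu : u.length = i) :
    numColourings Q (⟨.cap, i⟩ :: D) (u ++ w) = ∑ a, numColourings Q D (u ++ a :: a :: w) := by
  have := numColourings_cons (Q := Q) .cap D (v := []) w hu rfl
  simp only [List.nil_append] at this
  rw [this]
  simp only [pieceColourings, Multiset.map_map]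
  rfl

theorem numColourings_cup (hu : u.length = i) :
    numColourings Q (⟨.cup, i⟩ :: D) (u ++ a :: b :: w) =
    if a = b then numColourings Q D (u ++ w) else 0 := by
  have := numColourings_cons (Q := Q) .cup D (v := [a, b]) w hu rfl
  refine this.trans ?_
  by_cases h : a = b <;> simp [pieceColourings, h]

theorem numColourings_pos (hu : u.length = i) :
    numColourings Q (⟨.pos, i⟩ :: D) (u ++ a :: b :: w) =
    numColourings Q D (u ++ b :: Q.act a b :: w) := by
  have := numColourings_cons (Q := Q) .pos D (v := [a, b]) w hu rfl
  exact this.trans (by simp [pieceColourings])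

theorem numColourings_neg (hu : u.length = i) :
    numColourings Q (⟨.neg, i⟩ :: D) (u ++ a :: b :: w) =
    numColourings Q D (u ++ Q.act b a :: a :: w) := by
  have := numColourings_cons (Q := Q) .neg D (v := [a, b]) w hu rfl
  exact this.trans (by simp [pieceColourings])

theorem numColourings_cap_succ (hu : u.length = i) :
    numColourings Q (⟨.cap, i + 1⟩ :: D) (u ++ c :: w) =
    ∑ a, numColourings Q D (u ++ c :: a :: a :: w) := by
  simpa using numColourings_cap (Q := Q) (i := i + 1) (u := u ++ [c]) D w (by simp [hu])

theorem numColourings_cup_succ (hu : u.length = i) :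
    numColourings Q (⟨.cup, i + 1⟩ :: D) (u ++ c :: a :: b :: w) =
    if a = b then numColourings Q D (u ++ c :: w) else 0 := by
  simpa using numColourings_cup (Q := Q) (i := i + 1) (u := u ++ [c]) D a b w (by simp [hu])

theorem numColourings_pos_succ (hu : u.length = i) :
    numColourings Q (⟨.pos, i + 1⟩ :: D) (u ++ c :: a :: b :: w) =
    numColourings Q D (u ++ c :: b :: Q.act a b :: w) := by
  simpa using numColourings_pos (Q := Q) (i := i + 1) (u := u ++ [c]) D a b w (by simp [hu])

theorem numColourings_neg_succ (hu : u.length = i) :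
    numColourings Q (⟨.neg, i + 1⟩ :: D) (u ++ c :: a :: b :: w) =
    numColourings Q D (u ++ c :: Q.act b a :: a :: w) := by
  simpa using numColourings_neg (Q := Q) (i := i + 1) (u := u ++ [c]) D a b w (by simp [hu])

end pieces

theorem exists_append {α : Type*} {x : List α} {i : ℕ} (h : i ≤ x.length) :
    ∃ u w, x = u ++ w ∧ u.length = i :=
  ⟨x.take i, x.drop i, (List.take_append_drop i x).symm, List.length_take_of_le h⟩

theorem exists_append_two {α : Type*} {x : List α} {i : ℕ} (h : i + 2 ≤ x.length) :
    ∃ u a b w, x = u ++ a :: b :: w ∧ u.length = i := by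
  obtain ⟨u, w, rfl, hu⟩ := exists_append (x := x) (i := i) (by omega)
  rw [List.length_append] at h
  match w, h with
  | a :: b :: w, _ => exact ⟨u, a, b, w, rfl, hu⟩
  | [], h => simp at h; omega
  | [_], h => simp at h; omega

theorem exists_append_one {α : Type*} {x : List α} {i : ℕ} (h : i + 1 ≤ x.length) :
    ∃ u a w, x = u ++ a :: w ∧ u.length = i := by
  obtain ⟨u, w, rfl, hu⟩ := exists_append (x := x) (i := i) (by omega)
  rw [List.length_append] at h
  match w, h with
  | a :: w, _ => exact ⟨u, a, w, rfl, hu⟩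
  | [], h => simp at h; omega

theorem exists_append_three {α : Type*} {x : List α} {i : ℕ} (h : i + 3 ≤ x.length) :
    ∃ u a b c w, x = u ++ a :: b :: c :: w ∧ u.length = i := by
  obtain ⟨u, a, b, w, rfl, hu⟩ := exists_append_two (x := x) (i := i) (by omega)
  match w with
  | c :: w => exact ⟨u, a, b, c, w, rfl, hu⟩
  | [] => simp at h; omega

theorem numColourings_exchange (p q : Piece) (i k : ℕ) (B : Diagram) {x : List X}
    (h : i + p.inputs + k + q.inputs ≤ x.length) :
    numColourings Q (⟨q, i + p.inputs + k⟩ :: ⟨p, i⟩ :: B) x =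
      numColourings Q (⟨p, i⟩ :: ⟨q, i + p.outputs + k⟩ :: B) x := by
  obtain ⟨x, w', rfl, hx⟩ := exists_append h
  obtain ⟨x, v', rfl, hx⟩ := exists_append (x := x) (i := i + p.inputs + k) (by omega)
  obtain ⟨x, w, rfl, hx⟩ := exists_append (x := x) (i := i + p.inputs) (by omega)
  obtain ⟨u, v, rfl, hu⟩ := exists_append (x := x) (i := i) (by omega)
  simp only [List.length_append] at *
  have e1 := numColourings_cons (Q := Q) q (i := i + p.inputs + k) (⟨p, i⟩ :: B)
    (u := u ++ v ++ w) (v := v') w' (by simp; omega) (by omega)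
  have e2 := numColourings_cons (Q := Q) p (i := i) (⟨q, i + p.outputs + k⟩ :: B)
    (u := u) (v := v) (w ++ (v' ++ w')) (by omega) (by omega)
  have f1 : ∀ z, numColourings Q (⟨p, i⟩ :: B) (u ++ v ++ w ++ (z ++ w')) =
      ((pieceColourings Q p v).map fun y => numColourings Q B (u ++ (y ++ (w ++ (z ++ w'))))).sum := by
    intro z
    rw [← numColourings_cons (Q := Q) p (i := i) B (u := u) (v := v) (w ++ (z ++ w')) (by omega)
      (by omega)]
    simp only [List.append_assoc]
  have f2 : ∀ y ∈ pieceColourings Q p v,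
      numColourings Q (⟨q, i + p.outputs + k⟩ :: B) (u ++ (y ++ (w ++ (v' ++ w')))) =
      ((pieceColourings Q q v').map fun z =>
        numColourings Q B (u ++ (y ++ (w ++ (z ++ w'))))).sum := by
    intro y hy
    have hl := length_of_mem_pieceColourings hy
    have := numColourings_cons (Q := Q) q (i := i + p.outputs + k) B (u := u ++ (y ++ w))
      (v := v') w' (by simp; omega) (by omega)
    simpa only [List.append_assoc] using this
  simp only [f1] at e1
  rw [Multiset.map_congr rfl f2] at e2
  simp only [List.append_assoc] at e1 e2 ⊢
  rw [e1, e2, Multiset.sum_map_sum_map]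

/-- The quandle axioms match the Reidemeister moves: idempotence for the first, involutivity for the
second, self-distributivity for the third. Involutivity also makes orientations unnecessary. The
colourings below the move are compared with the whole remaining diagram `B` attached. -/
theorem numColourings_move {l r : Diagram} (h : Move l r) {n m m' : ℕ} {B : Diagram}
    (hl : IsTangle n (l ++ B) m) (hr : IsTangle n (r ++ B) m') {x : List X} (hx : x.length = n) :
    numColourings Q (l ++ B) x = numColourings Q (r ++ B) x := by
  subst hx
  cases h with
  | exchange p q i k => exact numColourings_exchange p q i k B hl.1
  | zigzagLeft i =>
    have h1 := hl.1
    have h2 := hl.2.1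
    simp only [Piece.inputs, Piece.outputs] at h1 h2
    obtain ⟨u, a, w, rfl, hu⟩ := exists_append_one (x := x) (i := i) (by omega)
    simp [numColourings_cap _ _ hu, numColourings_cup_succ _ _ _ _ _ hu]
  | zigzagRight i =>
    have h1 := hl.1
    simp only [Piece.inputs] at h1
    obtain ⟨u, a, w, rfl, hu⟩ := exists_append_one (x := x) (i := i) (by omega)
    simp [numColourings_cap_succ _ _ _ hu, numColourings_cup _ _ _ _ hu]
  | reidemeisterOneCap c hc i =>
    have h1 := hl.1
    simp only [Piece.inputs] at h1
    obtain ⟨u, w, rfl, hu⟩ := exists_append (x := x) (i := i) (by omega)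
    rcases hc with rfl | rfl <;>
      simp [numColourings_cap _ _ hu, numColourings_pos _ _ _ _ hu, numColourings_neg _ _ _ _ hu,
        Q.act_self]
  | reidemeisterOneCup c hc i =>
    have h1 : i + 2 ≤ x.length := hr.1
    obtain ⟨u, a, b, w, rfl, hu⟩ := exists_append_two (x := x) (i := i) (by omega)
    rcases hc with rfl | rfl <;>
      simp only [List.cons_append, List.nil_append, numColourings_cup _ _ _ _ hu,
        numColourings_pos _ _ _ _ hu, numColourings_neg _ _ _ _ hu]
    · refine if_congr ⟨fun h => ?_, fun h => ?_⟩ rfl rfl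
      · rw [← Q.act_act a b, ← h, Q.act_self]
      · rw [h, Q.act_self]
    · refine if_congr ⟨fun h => ?_, fun h => ?_⟩ rfl rfl
      · conv_rhs => rw [← Q.act_act b a, h, Q.act_self]
      · rw [h, Q.act_self]
  | reidemeisterTwo c hc i =>
    have h1 : i + 2 ≤ x.length := by rcases hc with rfl | rfl <;> exact hl.1
    obtain ⟨u, a, b, w, rfl, hu⟩ := exists_append_two (x := x) (i := i) (by omega)
    rcases hc with rfl | rfl <;>
      simp [Piece.mirror, numColourings_pos _ _ _ _ hu, numColourings_neg _ _ _ _ hu, Q.act_act]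
  | reidemeisterThree c hc i =>
    have h1 : i + 1 + 2 ≤ x.length := by rcases hc with rfl | rfl <;> exact hr.1
    obtain ⟨u, a, b, c, w, rfl, hu⟩ := exists_append_three (x := x) (i := i) (by omega)
    rcases hc with rfl | rfl <;>
      simp [numColourings_pos _ _ _ _ hu, numColourings_neg _ _ _ _ hu,
        numColourings_pos_succ _ _ _ _ _ hu, numColourings_neg_succ _ _ _ _ _ hu]
    · rw [Q.act_distrib]
    · rw [Q.act_distrib c b a]
  | slideCap c hc i =>
    have h1 : i + 1 ≤ x.length := by
      have := hr.1
      simpa [Piece.inputs] using this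
    obtain ⟨u, c, w, rfl, hu⟩ := exists_append_one (x := x) (i := i) (by omega)
    rcases hc with rfl | rfl <;>
      simp [Piece.mirror, numColourings_cap _ _ hu, numColourings_cap_succ _ _ _ hu,
        numColourings_pos _ _ _ _ hu, numColourings_neg _ _ _ _ hu,
        numColourings_pos_succ _ _ _ _ _ hu, numColourings_neg_succ _ _ _ _ _ hu]
    -- In the positive case the new arc passes under the strand coloured `c`, and the two sides name
    -- its colour on opposite sides of that strand. The sums agree after reindexing by the bijection
    -- `act · c`.
    rw [← (Q.act_bijective c).sum_comp
      (fun a => numColourings Q B (u ++ Q.act a c :: c :: a :: w))]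
    simp only [Q.act_act]
  | slideCup c hc i =>
    have h1 : i + 1 + 2 ≤ x.length := by rcases hc with rfl | rfl <;> exact hl.1
    obtain ⟨u, a, b, c, w, rfl, hu⟩ := exists_append_three (x := x) (i := i) (by omega)
    rcases hc with rfl | rfl <;>
      simp only [List.cons_append, List.nil_append, Piece.mirror, numColourings_cup _ _ _ _ hu,
        numColourings_cup_succ _ _ _ _ _ hu,
        numColourings_pos _ _ _ _ hu, numColourings_neg _ _ _ _ hu,
        numColourings_pos_succ _ _ _ _ _ hu, numColourings_neg_succ _ _ _ _ _ hu]
    · by_cases h : a = c <;> simp [h]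
    · refine if_congr ⟨fun h => ?_, fun h => ?_⟩ rfl rfl
      · rw [h, Q.act_act]
      · rw [← h, Q.act_act]

theorem numColourings_context {l r : Diagram} (h : Move l r) {A B : Diagram} {n m m' : ℕ}
    (hl : IsTangle n (A ++ (l ++ B)) m) (hr : IsTangle n (A ++ (r ++ B)) m') {x : List X}
    (hx : x.length = n) :
    numColourings Q (A ++ (l ++ B)) x = numColourings Q (A ++ (r ++ B)) x := by
  induction A generalizing n x with
  | nil => exact numColourings_move h hl hr hx
  | cons s A ih =>
    simp only [List.cons_append, numColourings]
    congr 1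
    refine Multiset.map_congr rfl fun y hy => ih hl.2 hr.2 ?_
    have := length_of_mem_pieceColourings hy
    have h1 := hl.1
    simp
    omega

/-- The number of colourings is an invariant of tangles. -/
theorem Isotopic.numColourings_eq {n m : ℕ} {D E : Diagram} (h : Isotopic n m D E) {x : List X}
    (hx : x.length = n) : numColourings Q D x = numColourings Q E x := by
  induction h with
  | rel D E h =>
    obtain ⟨hD, hE, A, B, l, r, hm, rfl, rfl⟩ := h
    simp only [List.append_assoc] at hD hE ⊢
    exact numColourings_context hm hD hE hx
  | refl D => rfl
  | symm D E _ ih => exact ih.symm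
  | trans D E F _ _ ih ih' => exact ih.trans ih'

end Colouring

/-! ### Counting components, and the cosmetic property -/

/-- The trivial quandle. -/
def trivialQuandle (X : Type*) : InvolutoryQuandle X :=
  ⟨fun a _ => a, fun _ => rfl, fun _ _ => rfl, fun _ _ _ => rfl⟩

/-- For the trivial quandle a crossing merely transposes two colours. The number of components
thereby becomes a special case of the colouring invariant. -/
theorem colourings_eq_numColourings {n m : ℕ} {D : Diagram} (h : IsTangle n D m) {x : List Bool}
    (hx : x.length = n) : colourings D x = numColourings (trivialQuandle Bool) D x := by
  induction D generalizing n x with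
  | nil => rfl
  | cons s D ih =>
    obtain ⟨p, i⟩ := s
    subst hx
    have h1 := h.1
    have h2 := h.2
    simp only at h1 h2
    cases p with
    | cap =>
      simp only [Piece.inputs, Piece.outputs] at h1 h2
      obtain ⟨u, w, rfl, hu⟩ := exists_append (x := x) (i := i) h1
      rw [numColourings_cap _ _ hu, Fintype.sum_bool, ← ih h2 (by simp; omega),
        ← ih h2 (by simp; omega)]
      subst hu
      simp [colourings, add_comm]
    | cup =>
      simp only [Piece.inputs, Piece.outputs] at h1 h2
      obtain ⟨u, a, b, w, rfl, hu⟩ := exists_append_two (x := x) (i := i) h1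
      rw [numColourings_cup _ _ _ _ hu, ← ih h2 (by simp; omega)]
      subst hu
      simp [colourings, List.drop_append, List.drop_eq_nil_of_le]
    | pos =>
      simp only [Piece.inputs, Piece.outputs] at h1 h2
      obtain ⟨u, a, b, w, rfl, hu⟩ := exists_append_two (x := x) (i := i) h1
      rw [numColourings_pos _ _ _ _ hu, ← ih h2 (by simp; omega)]
      subst hu
      simp [colourings, List.drop_append, List.drop_eq_nil_of_le, trivialQuandle]
    | neg =>
      simp only [Piece.inputs, Piece.outputs] at h1 h2
      obtain ⟨u, a, b, w, rfl, hu⟩ := exists_append_two (x := x) (i := i) h1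
      rw [numColourings_neg _ _ _ _ hu, ← ih h2 (by simp; omega)]
      subst hu
      simp [colourings, List.drop_append, List.drop_eq_nil_of_le, trivialQuandle]

theorem colourings_mirror (D : Diagram) (x : List Bool) :
    colourings (mirror D) x = colourings D x := by
  induction D generalizing x with
  | nil => rfl
  | cons s D ih =>
    obtain ⟨p, i⟩ := s
    cases p <;> simp only [mirror, List.map_cons, Piece.mirror, colourings] at ih ⊢ <;> simp only [ih]

theorem TangleIso.isLink {k : ℕ} {D E : Diagram} (h : TangleIso 0 0 D E) (hE : IsLink k E) :
    IsLink k D := by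
  refine ⟨h.1, ?_⟩
  rw [colourings_eq_numColourings h.1 rfl, h.3.numColourings_eq rfl,
    ← colourings_eq_numColourings h.2 rfl]
  exact hE.2

/-- Non-coherence needs no separate argument: the surgered link is isotopic to the mirror image of a
knot, and changing crossings does not alter the component count. -/
theorem bandIsChirallyCosmetic {R : Diagram} (hR : IsSymmetricTangle R) (hK : IsKnot (knotOf R)) :
    BandIsChirallyCosmetic R := by
  have h := surgery_isotopic hR
  refine ⟨hK, h.isLink ⟨h.2, ?_⟩, h.3⟩
  rw [colourings_mirror]
  exact hK.2

/-! ### An infinite family -/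

/-- A vertical column of `n` half-twists. -/
def column (n : ℕ) : Diagram := List.replicate n ⟨.neg, 0⟩

theorem shift_column (n : ℕ) : shift 1 (column n) = List.replicate n ⟨.neg, 1⟩ := by
  simp [shift, column]

theorem shift_upsideDown_column (n : ℕ) :
    shift 1 (upsideDown (column n)) = List.replicate n ⟨.pos, 1⟩ := by
  simp [shift, column, upsideDown, Piece.upsideDown]

theorem isTangle_column (n : ℕ) : IsTangle 2 (column n) 2 := by
  induction n with
  | zero => rfl
  | succ n ih => exact ⟨le_rfl, ih⟩

theorem rotate_column (n : ℕ) : rotate 2 (column n) = column n := by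
  induction n with
  | zero => rfl
  | succ n ih =>
    simp only [column, List.replicate_succ, rotate] at ih ⊢
    exact congrArg _ ih

theorem isSymmetricTangle_column (n : ℕ) : IsSymmetricTangle (column n) :=
  ⟨isTangle_column n, by rw [rotate_column]; exact Relation.EqvGen.refl _⟩

theorem isTangle_knotOf {R : Diagram} (hR : IsTangle 2 R 2) : IsTangle 0 (knotOf R) 0 := by
  have box : ∀ {X : Diagram}, IsTangle 2 X 2 → IsTangle 4 (shift 1 X) 4 := fun h =>
    (h.shift 1).widen 1
  have above : IsTangle 0 (aboveBand R) 8 :=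
    (IsTangle.append (n := 0) (k := 4) (by decide) (box hR)).append (k := 4) (by decide)
  have below : IsTangle 8 (belowBand R) 0 :=
    (IsTangle.append (n := 8) (k := 4) (by decide) (box hR.upsideDown)).append (by decide)
  exact above.append below

theorem colourings_replicate {p : Piece} (hp : p.IsCrossing) (n : ℕ) (D : Diagram) (a x y : Bool)
    (w : List Bool) : colourings (List.replicate n ⟨p, 1⟩ ++ D) (a :: x :: y :: w) =
      if Even n then colourings D (a :: x :: y :: w) else colourings D (a :: y :: x :: w) := by
  induction n generalizing x y with
  | zero => simp
  | succ n ih =>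
    have : colourings (List.replicate (n + 1) ⟨p, 1⟩ ++ D) (a :: x :: y :: w) =
        colourings (List.replicate n ⟨p, 1⟩ ++ D) (a :: y :: x :: w) := by
      rcases hp with rfl | rfl <;> simp [List.replicate_succ, colourings]
    rw [this, ih]
    by_cases h : Even n <;> simp [h, Nat.even_add_one]

theorem isKnot_knotOf_column (n : ℕ) : IsKnot (knotOf (column n)) := by
  refine ⟨isTangle_knotOf (isTangle_column n), ?_⟩
  have hp := fun D a x y w => colourings_replicate (p := .pos) (Or.inl rfl) n D a x y w
  have hn := fun D a x y w => colourings_replicate (p := .neg) (Or.inr rfl) n D a x y w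
  rw [knotOf, aboveBand, belowBand, shift_column, shift_upsideDown_column]
  by_cases h : Even n <;> simp [colourings, hp, hn, h]

/-! ### Dihedral colourings of the knots built from columns -/

/-- The dihedral quandle. -/
def dihedralQuandle (X : Type*) [CommRing X] : InvolutoryQuandle X where
  act a b := 2 * b - a
  act_self a := by ring
  act_act a b := by ring
  act_distrib a b c := by ring

/-- Eliminates two unknowns that the colouring equations determine: `e` in terms of `c`, and `c`
itself. -/
theorem sum_sum_ite_eq {X : Type*} [Fintype X] [DecidableEq X] (p : X → X) (q : X)
    (P : Prop) [Decidable P] :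
    (∑ c : X, ∑ e : X, if e = p c ∧ c = q ∧ P then 1 else 0) = if P then 1 else 0 := by
  simp only [ite_and, Finset.sum_ite_eq', Finset.mem_univ, if_true]

section Count

variable {X : Type*} [CommRing X] [Fintype X] [DecidableEq X]

/-- A dihedral crossing preserves the difference of its two colours and translates both by that
difference, up to sign; hence a column translates by `n` times the difference. -/
theorem numColourings_replicate_neg (n : ℕ) (D : Diagram) (a x y : X) (w : List X) :
    numColourings (dihedralQuandle X) (List.replicate n ⟨.neg, 1⟩ ++ D) (a :: x :: y :: w) =
      numColourings (dihedralQuandle X) D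
        (a :: (x - n * (y - x)) :: (y - n * (y - x)) :: w) := by
  induction n generalizing x y with
  | zero => simp
  | succ n ih =>
    have := numColourings_neg (Q := dihedralQuandle X) (i := 1) (u := [a])
      (List.replicate n ⟨.neg, 1⟩ ++ D) x y w rfl
    simp only [List.cons_append, List.nil_append] at this
    rw [List.replicate_succ, List.cons_append, this, ih]
    simp only [dihedralQuandle]
    congr 3
    · push_cast; ring
    · congr 1
      push_cast; ring

theorem numColourings_replicate_pos (n : ℕ) (D : Diagram) (a x y : X) (w : List X) :
    numColourings (dihedralQuandle X) (List.replicate n ⟨.pos, 1⟩ ++ D) (a :: x :: y :: w) =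
      numColourings (dihedralQuandle X) D
        (a :: (x + n * (y - x)) :: (y + n * (y - x)) :: w) := by
  induction n generalizing x y with
  | zero => simp
  | succ n ih =>
    have := numColourings_pos (Q := dihedralQuandle X) (i := 1) (u := [a])
      (List.replicate n ⟨.pos, 1⟩ ++ D) x y w rfl
    simp only [List.cons_append, List.nil_append] at this
    rw [List.replicate_succ, List.cons_append, this, ih]
    simp only [dihedralQuandle]
    congr 3
    · push_cast; ring
    · congr 1
      push_cast; ring

theorem numColourings_pos_zero (D : Diagram) (a b : X) (w : List X) :
    numColourings (dihedralQuandle X) (⟨.pos, 0⟩ :: D) (a :: b :: w) =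
      numColourings (dihedralQuandle X) D (b :: (2 * b - a) :: w) :=
  numColourings_pos (u := []) D a b w rfl

theorem numColourings_pos_one (D : Diagram) (a b c : X) (w : List X) :
    numColourings (dihedralQuandle X) (⟨.pos, 1⟩ :: D) (a :: b :: c :: w) =
      numColourings (dihedralQuandle X) D (a :: c :: (2 * c - b) :: w) :=
  numColourings_pos (u := [a]) D b c w rfl

theorem numColourings_pos_three (D : Diagram) (a b c d e : X) (w : List X) :
    numColourings (dihedralQuandle X) (⟨.pos, 3⟩ :: D) (a :: b :: c :: d :: e :: w) =
      numColourings (dihedralQuandle X) D (a :: b :: c :: e :: (2 * e - d) :: w) :=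
  numColourings_pos (u := [a, b, c]) D d e w rfl

theorem numColourings_pos_four (D : Diagram) (a b c d e f : X) (w : List X) :
    numColourings (dihedralQuandle X) (⟨.pos, 4⟩ :: D) (a :: b :: c :: d :: e :: f :: w) =
      numColourings (dihedralQuandle X) D (a :: b :: c :: d :: f :: (2 * f - e) :: w) :=
  numColourings_pos (u := [a, b, c, d]) D e f w rfl

theorem numColourings_neg_zero (D : Diagram) (a b : X) (w : List X) :
    numColourings (dihedralQuandle X) (⟨.neg, 0⟩ :: D) (a :: b :: w) =
      numColourings (dihedralQuandle X) D ((2 * a - b) :: a :: w) :=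
  numColourings_neg (u := []) D a b w rfl

theorem numColourings_neg_one (D : Diagram) (a b c : X) (w : List X) :
    numColourings (dihedralQuandle X) (⟨.neg, 1⟩ :: D) (a :: b :: c :: w) =
      numColourings (dihedralQuandle X) D (a :: (2 * b - c) :: b :: w) :=
  numColourings_neg (u := [a]) D b c w rfl

theorem numColourings_neg_three (D : Diagram) (a b c d e : X) (w : List X) :
    numColourings (dihedralQuandle X) (⟨.neg, 3⟩ :: D) (a :: b :: c :: d :: e :: w) =
      numColourings (dihedralQuandle X) D (a :: b :: c :: (2 * d - e) :: d :: w) :=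
  numColourings_neg (u := [a, b, c]) D d e w rfl

theorem numColourings_neg_four (D : Diagram) (a b c d e f : X) (w : List X) :
    numColourings (dihedralQuandle X) (⟨.neg, 4⟩ :: D) (a :: b :: c :: d :: e :: f :: w) =
      numColourings (dihedralQuandle X) D (a :: b :: c :: d :: (2 * e - f) :: e :: w) :=
  numColourings_neg (u := [a, b, c, d]) D e f w rfl

theorem numColourings_cup_zero (D : Diagram) (a b : X) (w : List X) :
    numColourings (dihedralQuandle X) (⟨.cup, 0⟩ :: D) (a :: b :: w) =
      if a = b then numColourings (dihedralQuandle X) D (w) else 0 :=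
  numColourings_cup (u := []) D a b w rfl

theorem numColourings_cup_two (D : Diagram) (a b c d : X) (w : List X) :
    numColourings (dihedralQuandle X) (⟨.cup, 2⟩ :: D) (a :: b :: c :: d :: w) =
      if c = d then numColourings (dihedralQuandle X) D (a :: b :: w) else 0 :=
  numColourings_cup (u := [a, b]) D c d w rfl

theorem numColourings_cup_three (D : Diagram) (a b c d e : X) (w : List X) :
    numColourings (dihedralQuandle X) (⟨.cup, 3⟩ :: D) (a :: b :: c :: d :: e :: w) =
      if d = e then numColourings (dihedralQuandle X) D (a :: b :: c :: w) else 0 :=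
  numColourings_cup (u := [a, b, c]) D d e w rfl

theorem numColourings_cap_zero (D : Diagram) (w : List X) :
    numColourings (dihedralQuandle X) (⟨.cap, 0⟩ :: D) (w) =
      ∑ x, numColourings (dihedralQuandle X) D (x :: x :: w) :=
  numColourings_cap (u := []) D w rfl

theorem numColourings_cap_two (D : Diagram) (a b : X) (w : List X) :
    numColourings (dihedralQuandle X) (⟨.cap, 2⟩ :: D) (a :: b :: w) =
      ∑ x, numColourings (dihedralQuandle X) D (a :: b :: x :: x :: w) :=
  numColourings_cap (u := [a, b]) D w rfl

theorem numColourings_cap_three (D : Diagram) (a b c : X) (w : List X) :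
    numColourings (dihedralQuandle X) (⟨.cap, 3⟩ :: D) (a :: b :: c :: w) =
      ∑ x, numColourings (dihedralQuandle X) D (a :: b :: c :: x :: x :: w) :=
  numColourings_cap (u := [a, b, c]) D w rfl

theorem numColourings_nil (x : List X) : numColourings (dihedralQuandle X) [] x = 1 := rfl

/-- The four maxima contribute unknown colours `a`, `b`, `c`, `e`, and the four minima contribute
four linear equations. These determine `e` and `c` from `a` and `b`; what remains is equivalent to
the single equation in `b - a`. -/
theorem numColourings_knotOf_column (n : ℕ) :
    numColourings (dihedralQuandle X) (knotOf (column n)) [] =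
      ∑ a : X, ∑ b : X, if (4 * (n : X) ^ 2 + 1) * (b - a) = 0 then 1 else 0 := by
  rw [knotOf, aboveBand, belowBand, shift_column, shift_upsideDown_column]
  simp only [List.cons_append, List.nil_append, List.append_assoc,
    numColourings_pos_zero, numColourings_pos_one, numColourings_pos_three, numColourings_pos_four,
    numColourings_neg_one, numColourings_neg_three, numColourings_neg_four, numColourings_cup_zero,
    numColourings_cup_two, numColourings_cup_three, numColourings_cap_zero, numColourings_cap_two,
    numColourings_cap_three, numColourings_replicate_neg, numColourings_replicate_pos,
    numColourings_nil]
  refine Finset.sum_congr rfl fun a _ => Finset.sum_congr rfl fun b _ => ?_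
  -- The solutions for `e` and `c`: the kink forces `e` to be the colour of the strand leaving the
  -- box at its lower right.
  rw [← sum_sum_ite_eq (fun _ => b - n * (b - a)) (b - n * (b - a) + 2 * n ^ 2 * (b - a))]
  refine Finset.sum_congr rfl fun c _ => Finset.sum_congr rfl fun e _ => ?_
  simp only [← ite_and]
  refine if_congr ⟨fun ⟨h1, h2, h3, h4⟩ => ⟨?_, ?_, ?_⟩, fun ⟨he, hc, hd⟩ => ?_⟩ rfl rfl
  · linear_combination -h1
  · linear_combination h3 + n * (h3 + h4) - h1
  · linear_combination h2 - 2 * (h3 + n * (h3 + h4))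
  · subst he hc
    refine ⟨?_, ?_, ?_, ?_⟩
    · ring
    · linear_combination hd
    · linear_combination n * hd
    · linear_combination -(1 + n) * hd

theorem numColourings_mirror_knotOf_column (n : ℕ) :
    numColourings (dihedralQuandle X) (mirror (knotOf (column n))) [] =
      ∑ a : X, ∑ b : X, if (4 * (n : X) ^ 2 + 1) * (b - a) = 0 then 1 else 0 := by
  rw [knotOf, aboveBand, belowBand, shift_column, shift_upsideDown_column]
  simp only [mirror, List.map_cons, List.map_nil, List.map_append, List.map_replicate, Piece.mirror,
    List.cons_append, List.nil_append, List.append_assoc,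
    numColourings_pos_one, numColourings_pos_three, numColourings_pos_four, numColourings_neg_zero,
    numColourings_neg_one, numColourings_neg_three, numColourings_neg_four, numColourings_cup_zero,
    numColourings_cup_two, numColourings_cup_three, numColourings_cap_zero, numColourings_cap_two,
    numColourings_cap_three, numColourings_replicate_neg, numColourings_replicate_pos,
    numColourings_nil]
  refine Finset.sum_congr rfl fun a _ => Finset.sum_congr rfl fun b _ => ?_
  -- After the crossing changes the solution for `e` involves `c`, but the same equation in `b - a`
  -- is left over.
  rw [← sum_sum_ite_eq (fun c => 2 * c - (b + n * (b - a)))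
    (a + n * (b - a) - 2 * n ^ 2 * (b - a))]
  refine Finset.sum_congr rfl fun c _ => Finset.sum_congr rfl fun e _ => ?_
  simp only [← ite_and]
  refine if_congr ⟨fun ⟨h1, h2, h3, h4⟩ => ⟨h1, ?_, ?_⟩, fun ⟨he, hc, hd⟩ => ?_⟩ rfl rfl
  · linear_combination -h4 - n * (h3 + h4)
  · linear_combination h2 - 2 * h4 - 2 * n * (h3 + h4)
  · subst hc
    subst he
    refine ⟨rfl, ?_, ?_, ?_⟩
    · linear_combination hd
    · linear_combination -(1 + n) * hd
    · linear_combination n * hd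

end Count

/-- Modulo `4n² + 1` the coefficient for `n` vanishes and all pairs count, whereas `0 < 4m² + 1 < N`
keeps the coefficient for `m` nonzero. -/
theorem sum_ite_lt_sum_ite {m n : ℕ} (h : m < n) {N : ℕ} [NeZero N] (hN : N = 4 * n ^ 2 + 1) :
    (∑ a : ZMod N, ∑ b : ZMod N, if (4 * (m : ZMod N) ^ 2 + 1) * (b - a) = 0 then 1 else 0) <
      ∑ a : ZMod N, ∑ b : ZMod N, if (4 * (n : ZMod N) ^ 2 + 1) * (b - a) = 0 then 1 else 0 := by
  have hn : (4 * (n : ZMod N) ^ 2 + 1) = 0 := by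
    have := ZMod.natCast_self N
    rw [hN] at this ⊢
    exact_mod_cast this
  have hm : (4 * (m : ZMod N) ^ 2 + 1) ≠ 0 := by
    intro h0
    have h1 : ((4 * m ^ 2 + 1 : ℕ) : ZMod N) = 0 := by exact_mod_cast h0
    have h2 := Nat.le_of_dvd (by omega) ((ZMod.natCast_eq_zero_iff _ _).1 h1)
    have h3 : m ^ 2 < n ^ 2 := Nat.pow_lt_pow_left h (by omega)
    omega
  simp only [hn, zero_mul, if_true]
  refine Finset.sum_lt_sum (fun a _ => Finset.sum_le_sum fun b _ => by split_ifs <;> simp)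
    -- The pair `a = 0`, `b = 1` is lost for `m`, since there the condition says that the
    -- coefficient itself is zero.
    ⟨0, Finset.mem_univ _, Finset.sum_lt_sum (fun b _ => by split_ifs <;> simp)
      ⟨1, Finset.mem_univ _, ?_⟩⟩
  simp [hm]

theorem numColourings_knotOf_column_ne {m n : ℕ} (h : m < n) :
    numColourings (dihedralQuandle (ZMod (4 * n ^ 2 + 1))) (knotOf (column m)) [] ≠
      numColourings (dihedralQuandle (ZMod (4 * n ^ 2 + 1))) (knotOf (column n)) [] := by
  rw [numColourings_knotOf_column, numColourings_knotOf_column]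
  exact (sum_ite_lt_sum_ite h rfl).ne

theorem numColourings_mirror_knotOf_column_eq {X : Type*} [CommRing X] [Fintype X] [DecidableEq X]
    (n : ℕ) : numColourings (dihedralQuandle X) (mirror (knotOf (column n))) [] =
      numColourings (dihedralQuandle X) (knotOf (column n)) [] := by
  rw [numColourings_knotOf_column, numColourings_mirror_knotOf_column]

/-- Stated for any `D` with the same colouring counts, so that it applies to the knots and to their
mirror images alike. The modulus is taken from the larger of the two indices. -/
theorem not_isotopic_of_numColourings {D : ℕ → Diagram}
    (hD : ∀ n, ∀ (X : Type) [CommRing X] [Fintype X] [DecidableEq X],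
      numColourings (dihedralQuandle X) (D n) [] =
        numColourings (dihedralQuandle X) (knotOf (column n)) []) {m n : ℕ} (h : m ≠ n) :
    ¬ LinkIsotopic (knotOf (column m)) (D n) := by
  intro hi
  rcases lt_or_gt_of_ne h with h | h
  · refine numColourings_knotOf_column_ne h ?_
    rw [← hD n, hi.numColourings_eq rfl]
  · refine numColourings_knotOf_column_ne h ?_
    rw [← hD n, hi.numColourings_eq rfl]

theorem bandIsChirallyCosmetic_column (n : ℕ) : BandIsChirallyCosmetic (column n) :=
  bandIsChirallyCosmetic (isSymmetricTangle_column n) (isKnot_knotOf_column n)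

end SlicedDiagram

theorem mainTheorem4 :
    -- for every symmetric tangle, the band on the resulting knot is chirally cosmetic
    (∀ R : SlicedDiagram.Diagram, SlicedDiagram.IsSymmetricTangle R →
      SlicedDiagram.IsKnot (SlicedDiagram.knotOf R) →
      SlicedDiagram.BandIsChirallyCosmetic R) ∧
    -- the knot `5₁`
    (SlicedDiagram.IsSymmetricTangle SlicedDiagram.oneHalfTwist ∧
      SlicedDiagram.LinkIsotopic (SlicedDiagram.knotOf SlicedDiagram.oneHalfTwist)
        SlicedDiagram.knotFiveOne ∧
      SlicedDiagram.BandIsChirallyCosmetic SlicedDiagram.oneHalfTwist) ∧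
    -- the mirror image of the knot `7₃`
    (SlicedDiagram.IsSymmetricTangle SlicedDiagram.threeHalfTwists ∧
      SlicedDiagram.LinkIsotopic (SlicedDiagram.knotOf SlicedDiagram.threeHalfTwists)
        (SlicedDiagram.mirror SlicedDiagram.knotSevenThree) ∧
      SlicedDiagram.BandIsChirallyCosmetic SlicedDiagram.threeHalfTwists) ∧
    -- the knot `8₈`
    (SlicedDiagram.IsSymmetricTangle SlicedDiagram.threeCrossingTangle ∧
      SlicedDiagram.LinkIsotopic (SlicedDiagram.knotOf SlicedDiagram.threeCrossingTangle)
        SlicedDiagram.knotEightEight ∧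
      SlicedDiagram.BandIsChirallyCosmetic SlicedDiagram.threeCrossingTangle) ∧
    -- infinitely many knots, pairwise distinct even up to mirror image
    (∃ R : ℕ → SlicedDiagram.Diagram,
      (∀ n, SlicedDiagram.IsSymmetricTangle (R n) ∧ SlicedDiagram.BandIsChirallyCosmetic (R n)) ∧
      ∀ m n, m ≠ n →
        ¬ SlicedDiagram.LinkIsotopic (SlicedDiagram.knotOf (R m)) (SlicedDiagram.knotOf (R n)) ∧
        ¬ SlicedDiagram.LinkIsotopic (SlicedDiagram.knotOf (R m))
          (SlicedDiagram.mirror (SlicedDiagram.knotOf (R n)))) := by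
  open SlicedDiagram in
  exact ⟨fun R hR hK => bandIsChirallyCosmetic hR hK,
    ⟨isSymmetricTangle_oneHalfTwist, knotOf_oneHalfTwist,
      bandIsChirallyCosmetic isSymmetricTangle_oneHalfTwist ⟨by decide, by decide⟩⟩,
    ⟨isSymmetricTangle_threeHalfTwists, knotOf_threeHalfTwists,
      bandIsChirallyCosmetic isSymmetricTangle_threeHalfTwists
        ⟨by decide, by decide +kernel⟩⟩,
    ⟨isSymmetricTangle_threeCrossingTangle, knotOf_threeCrossingTangle,
      bandIsChirallyCosmetic isSymmetricTangle_threeCrossingTangle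
        ⟨by decide, by decide +kernel⟩⟩,
    -- The shift makes the family start with a single crossing, that is with `oneHalfTwist`, rather
    -- than with the empty column.
    fun n => column (n + 1),
    fun n => ⟨isSymmetricTangle_column _, bandIsChirallyCosmetic_column _⟩,
    fun m n h => ⟨not_isotopic_of_numColourings (D := fun n => knotOf (column n))
        (fun _ _ _ _ _ => rfl) (by omega),
      not_isotopic_of_numColourings (D := fun n => mirror (knotOf (column n)))
        (fun n _ _ _ _ => numColourings_mirror_knotOf_column_eq n) (by omega)⟩⟩
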